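/- For real $\delta>0$, a finite set $S\subseteq\{0,1\}^d$ and $a\in\{0,1\}^d$, a $\delta$-approximate nearest neighbor of $a$ in $S$ is a point $b\in S\setminus\{a\}$ with $\mathrm{ham}(a,b)\le(1+\delta)\,\mathrm{ham}(a,c)$ for all $c\in S\setminus\{a\}$, where $\mathrm{ham}$ is the Hamming distance. Theorem. For every constant $\alpha\ge 1$ there is a randomized algorithm with the following property. Given $\delta\in(0,\frac12)$, integers $n,d\ge 2$ and (a list of the points of) a set $S$ of $n$ points in $\{0,1\}^d$, it always halts in time $$O\!\left(\frac{\log(nd)}{\delta^2}\Bigl(nd\,\log_{1+\delta}d+n^2\log\log_{1+\delta}d\Bigr)\right),$$ and with probability at least $1-(nd)^{-\alpha}$ it outputs, simultaneously for all points of $S$, a $\delta$-approximate nearest neighbor in $S$. The constant in the $O$ depends only on $\alpha$. The model of computation is the randomized word RAM with words of at least $c\log_2(nd)$ bits, for a constant $c$ depending only on $\alpha$: arithmetic, comparison, memory access and drawing a uniformly random word each take one step, and the real number $\delta$ can be accessed only by tests $u\le\delta v$ for words $u,v$, one step each. -/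

import Mathlib

open MeasureTheory

/-! ### Approximate nearest neighbours in the Hamming cube -/

/-- `b` is a `δ`-approximate nearest neighbour of `a` in the finite set `S` of points of the
Hamming cube: `b ∈ S \ {a}` and `ham(a, b) ≤ (1 + δ) ham(a, c)` for every `c ∈ S \ {a}`. -/
def IsApproxNearestNeighbor {d : ℕ} (δ : ℝ) (S : Finset (Fin d → Bool))
    (a b : Fin d → Bool) : Prop :=
  b ∈ S \ {a} ∧
    ∀ c ∈ S \ {a}, (hammingDist a b : ℝ) ≤ (1 + δ) * (hammingDist a c : ℝ)

/-! ### A randomized word RAM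

The machine has registers and a random-access memory, both indexed by natural numbers; their
contents are `w`-bit words, that is natural numbers below `2 ^ w`. A program mentions finitely many
registers; the memory is addressed indirectly. Each arithmetic operation, comparison, memory access,
test and random draw has cost one. The machine also has a real parameter `δ` as input, which it can
only compare with the ratio of two words. Programs are finite syntactic objects that do not depend
on the input, on `δ`, or on `w`. -/

namespace WordRAM

/-- Arithmetic operations and comparisons on words. -/
inductive BinOp where
  | add | sub | mul | div | mod | lt | eq

/-- The value of an operation on `w`-bit words: arithmetic is modulo `2 ^ w`, `div` and `mod` are
quotient and remainder (`x div 0 = 0`, `x mod 0 = x`), and a comparison returns `1` (true) or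
`0` (false). -/
def BinOp.eval (w : ℕ) : BinOp → ℕ → ℕ → ℕ
  | .add, a, b => (a + b) % 2 ^ w
  | .sub, a, b => (a + (2 ^ w - b)) % 2 ^ w
  | .mul, a, b => (a * b) % 2 ^ w
  | .div, a, b => a / b
  | .mod, a, b => a % b
  | .lt, a, b => if a < b then 1 else 0
  | .eq, a, b => if a = b then 1 else 0

/-- Expressions: literals, registers, memory reads at a computed address, operations on words, and
the test `e₁ ≤ δ * e₂` against the real parameter. -/
inductive Expr where
  | lit (c : ℕ)
  | reg (x : ℕ)
  | load (addr : Expr)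
  | op (o : BinOp) (e₁ e₂ : Expr)
  | leParam (e₁ e₂ : Expr)

/-- The cost of evaluating an expression: one per syntactic node. -/
def Expr.cost : Expr → ℕ
  | .lit _ => 1
  | .reg _ => 1
  | .load a => 1 + a.cost
  | .op _ e₁ e₂ => 1 + e₁.cost + e₂.cost
  | .leParam e₁ e₂ => 1 + e₁.cost + e₂.cost

/-- A state of the machine: registers, memory, and the number of random words drawn so far. -/
structure State where
  regs : ℕ → ℕ
  mem : ℕ → ℕ
  drawn : ℕ

open Classical in
/-- The value of an expression in a state, for word length `w` and real parameter `δ`. -/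
noncomputable def Expr.eval (w : ℕ) (δ : ℝ) (s : State) : Expr → ℕ
  | .lit c => c % 2 ^ w
  | .reg x => s.regs x
  | .load a => s.mem (a.eval w δ s)
  | .op o e₁ e₂ => o.eval w (e₁.eval w δ s) (e₂.eval w δ s)
  | .leParam e₁ e₂ =>
      if ((e₁.eval w δ s : ℕ) : ℝ) ≤ δ * ((e₂.eval w δ s : ℕ) : ℝ) then 1 else 0

/-- Programs. -/
inductive Prog where
  | skip
  | assign (x : ℕ) (e : Expr)
  | store (addr e : Expr)
  | random (x : ℕ)
  | seq (p q : Prog)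
  | ite (e : Expr) (p q : Prog)
  | loop (e : Expr) (p : Prog)

/-- `Exec w δ ω p s s' t`: on `w`-bit words, with real parameter `δ` and random words
`ω 0, ω 1, …`, the program `p` started in state `s` halts in state `s'` after `t` steps. A test
succeeds when its value is not `0`; `loop e p` repeats `p` while the test `e` succeeds. -/
inductive Exec (w : ℕ) (δ : ℝ) (ω : ℕ → Fin (2 ^ w)) : Prog → State → State → ℕ → Prop where
  | skip (s : State) : Exec w δ ω .skip s s 1
  | assign (x : ℕ) (e : Expr) (s : State) :
      Exec w δ ω (.assign x e) s
        { s with regs := Function.update s.regs x (e.eval w δ s) } (1 + e.cost)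
  | store (a e : Expr) (s : State) :
      Exec w δ ω (.store a e) s
        { s with mem := Function.update s.mem (a.eval w δ s) (e.eval w δ s) }
        (1 + a.cost + e.cost)
  | random (x : ℕ) (s : State) :
      Exec w δ ω (.random x) s
        { s with regs := Function.update s.regs x (ω s.drawn), drawn := s.drawn + 1 } 1
  | seq {p q : Prog} {s s' s'' : State} {t t' : ℕ} :
      Exec w δ ω p s s' t → Exec w δ ω q s' s'' t' → Exec w δ ω (.seq p q) s s'' (t + t')
  | ite_true {e : Expr} {p q : Prog} {s s' : State} {t : ℕ} :
      e.eval w δ s ≠ 0 → Exec w δ ω p s s' t → Exec w δ ω (.ite e p q) s s' (1 + e.cost + t)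
  | ite_false {e : Expr} {p q : Prog} {s s' : State} {t : ℕ} :
      e.eval w δ s = 0 → Exec w δ ω q s s' t → Exec w δ ω (.ite e p q) s s' (1 + e.cost + t)
  | loop_false {e : Expr} {p : Prog} {s : State} :
      e.eval w δ s = 0 → Exec w δ ω (.loop e p) s s (1 + e.cost)
  | loop_true {e : Expr} {p : Prog} {s s' s'' : State} {t t' : ℕ} :
      e.eval w δ s ≠ 0 → Exec w δ ω p s s' t → Exec w δ ω (.loop e p) s' s'' t' →
        Exec w δ ω (.loop e p) s s'' (1 + e.cost + t + t')

/-- The law of the random words: independent and uniformly distributed `w`-bit words. -/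
noncomputable def randomWords (w : ℕ) : Measure (ℕ → Fin (2 ^ w)) :=
  Measure.infinitePi fun _ : ℕ => (PMF.uniformOfFintype (Fin (2 ^ w))).toMeasure

/-- The initial state for a list of `n` points of `{0,1}^d`: register `0` holds `n`, register `1`
holds `d`, memory cell `i * d + j` holds coordinate `j` of point `i` for `i < n` and `j < d`, and
everything else is `0`. -/
def inputState {n d : ℕ} (x : Fin n → Fin d → Bool) : State where
  regs r := if r = 0 then n else if r = 1 then d else 0
  mem a :=
    if h : a / d < n ∧ a % d < d then (if x ⟨a / d, h.1⟩ ⟨a % d, h.2⟩ then 1 else 0) else 0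
  drawn := 0

end WordRAM

/-- The expression inside the `O` of the running time:
`(log (n d) / δ²) (n d log_{1+δ} d + n² log log_{1+δ} d)`. -/
noncomputable def nnTimeBound (δ : ℝ) (n d : ℕ) : ℝ :=
  (Real.log ((n : ℝ) * d) / δ ^ 2) *
    ((n : ℝ) * d * Real.logb (1 + δ) d + (n : ℝ) ^ 2 * Real.log (Real.logb (1 + δ) d))

/-! The algorithm estimates distances by random parities at dyadic sampling rates. At scale `i` a
sketch bit of a point is the parity of its coordinates on a random set containing each coordinate
independently with probability `2 ^ -(i + 1)`. Two points at distance `h` get different bits with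
probability `diffProb i h = (1 - (1 - 2 ^ -i) ^ h) / 2`, an increasing function of `h`. With `m` of
order `log (n d) / δ²` bits per scale, Hoeffding's inequality and a union bound over scales and
pairs (`measure_sketch_close`, `failure_le`) put every sketch distance within `δ m / 100` of its
mean, outside an event of probability `(n d) ^ -α`.

For a fixed point `a`, a scale is far when all sketch distances from `a` are at least `3 m / 32`. A
binary search over the `O(log d)` scales finds a far scale `i` followed by one that is not far.
There the least distance `h` from `a` satisfies `diffProb i h ≥ 1 / 16` and `diffProb (i + 1) h ≤ 1
/ 8`, so `diffProb i` is neither too small nor saturated at `h`. Increasing the distance by a factor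
of more than `1 + δ` then increases `diffProb i` by at least `27 δ / 1024`, more than twice the
estimation error (`diffProb_gap`). Hence a nearest row in the sketch at scale `i` is a
`δ`-approximate nearest neighbour (`IsSelected.le_mul`).

The parameter `δ` enters the program only through `k = min ⌈1 / δ⌉ (d + 1)`. If `δ k ≥ 1`, then `k²`
serves as `1 / δ²` in the sketch length. Otherwise `δ (d + 1) < 1`, and comparing all pairs exactly
costs `O(n² d)`, which is within the bound because `d ≤ 1 / δ²`. The truncation keeps all numbers
polynomial in `n d`, however small `δ` is.

The time bounds come from a Hoare logic for the machine. Its postconditions express each sketch bit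
as an explicit function of the random words, and the probabilistic argument concerns only those
functions. -/

namespace WordRAM

/-! ### A Hoare logic with time bounds -/

/-- Started in the state `s`, the program `p` halts within `T` steps in a state satisfying `Q`. -/
def Runs (w : ℕ) (δ : ℝ) (ω : ℕ → Fin (2 ^ w)) (p : Prog) (s : State) (T : ℕ)
    (Q : State → Prop) : Prop :=
  ∃ s' t, Exec w δ ω p s s' t ∧ t ≤ T ∧ Q s'

section Rules

variable {w : ℕ} {δ : ℝ} {ω : ℕ → Fin (2 ^ w)} {p q : Prog} {e : Expr} {s : State}
  {T T' : ℕ} {Q Q' : State → Prop}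

theorem Runs.mono (h : Runs w δ ω p s T Q) (hT : T ≤ T') (hQ : ∀ s, Q s → Q' s) :
    Runs w δ ω p s T' Q' := by
  obtain ⟨s', t, h, ht, hs⟩ := h
  exact ⟨s', t, h, ht.trans hT, hQ _ hs⟩

theorem Runs.seq (h : Runs w δ ω p s T fun s' => Runs w δ ω q s' T' Q) :
    Runs w δ ω (.seq p q) s (T + T') Q := by
  obtain ⟨s', t, h, ht, s'', t', h', ht', hs⟩ := h
  exact ⟨s'', t + t', .seq h h', add_le_add ht ht', hs⟩

theorem Runs.skip (h : Q s) : Runs w δ ω .skip s 1 Q :=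
  ⟨s, 1, .skip s, le_rfl, h⟩

theorem Runs.ite_true (he : e.eval w δ s ≠ 0) (h : Runs w δ ω p s T Q) :
    Runs w δ ω (.ite e p q) s (1 + e.cost + T) Q := by
  obtain ⟨s', t, h, ht, hs⟩ := h
  exact ⟨s', _, .ite_true he h, by omega, hs⟩

theorem Runs.ite_false (he : e.eval w δ s = 0) (h : Runs w δ ω q s T Q) :
    Runs w δ ω (.ite e p q) s (1 + e.cost + T) Q := by
  obtain ⟨s', t, h, ht, hs⟩ := h
  exact ⟨s', _, .ite_false he h, by omega, hs⟩

/-- A loop whose body runs at most `N` times, with invariant `I k` after `k` rounds. -/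
theorem Runs.loop {I : ℕ → State → Prop} (N : ℕ) (h0 : I 0 s)
    (hend : ∀ k s, I k s → e.eval w δ s = 0 → Q s)
    (hstep : ∀ k s, I k s → e.eval w δ s ≠ 0 → k < N ∧ Runs w δ ω p s T (I (k + 1))) :
    Runs w δ ω (.loop e p) s (N * (1 + e.cost + T) + (1 + e.cost)) Q := by
  suffices H : ∀ r k s, N ≤ k + r → I k s →
      Runs w δ ω (.loop e p) s (r * (1 + e.cost + T) + (1 + e.cost)) Q from
    H N 0 s (by simp) h0
  intro r
  induction r with
  | zero =>
    intro k s hk hI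
    have he : e.eval w δ s = 0 := by
      by_contra he
      have := (hstep k s hI he).1
      omega
    exact ⟨s, _, .loop_false he, by simp, hend k s hI he⟩
  | succ r ih =>
    intro k s hk hI
    by_cases he : e.eval w δ s = 0
    · exact ⟨s, _, .loop_false he, by simp, hend k s hI he⟩
    · obtain ⟨-, s', t, h, ht, hI'⟩ := hstep k s hI he
      obtain ⟨s'', t', h', ht', hs⟩ := ih (k + 1) s' (by omega) hI'
      exact ⟨s'', _, .loop_true he h h', by rw [add_mul, one_mul]; omega, hs⟩

/-- A loop whose body runs exactly `N` times. -/
theorem Runs.for {I : ℕ → State → Prop} (N : ℕ) (h0 : I 0 s)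
    (htest : ∀ k s, k ≤ N → I k s → (e.eval w δ s ≠ 0 ↔ k < N))
    (hstep : ∀ k s, k < N → I k s → Runs w δ ω p s T (I (k + 1)))
    (hend : ∀ s, I N s → Q s) :
    Runs w δ ω (.loop e p) s (N * (1 + e.cost + T) + (1 + e.cost)) Q := by
  refine Runs.loop (I := fun k s => k ≤ N ∧ I k s) N ⟨N.zero_le, h0⟩ ?_ ?_
  · rintro k s ⟨hk, hI⟩ he
    have : ¬ k < N := fun h => (htest k s hk hI).2 h he
    obtain rfl : k = N := by omega
    exact hend s hI
  · rintro k s ⟨hk, hI⟩ he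
    have hk' := (htest k s hk hI).1 he
    exact ⟨hk', (hstep k s hk' hI).mono le_rfl fun s h => ⟨hk', h⟩⟩

/-! ### States with finitely many registers in use -/

/-- The state with the entries of the list `l` in the first registers. -/
def conf (l : List ℕ) (M : ℕ → ℕ) (r : ℕ) : State := ⟨fun x => l.getD x 0, M, r⟩

variable {l : List ℕ} {M : ℕ → ℕ} {r : ℕ}

theorem update_getD {x : ℕ} (hx : x < l.length) (v : ℕ) :
    Function.update (fun x => l.getD x 0) x v = fun y => (l.set x v).getD y 0 := by
  funext y
  by_cases h : y = x
  · subst h; simp [List.getD, hx]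
  · simp [List.getD, h, Ne.symm h]

theorem Runs.assign {x v : ℕ} (hv : e.eval w δ (conf l M r) = v) (hx : x < l.length)
    (h : Q (conf (l.set x v) M r)) :
    Runs w δ ω (.assign x e) (conf l M r) (1 + e.cost) Q := by
  refine ⟨_, _, .assign x e _, le_rfl, ?_⟩
  rw [hv]
  simpa only [conf, update_getD hx] using h

theorem Runs.assign_seq {x v : ℕ} (hv : e.eval w δ (conf l M r) = v) (hx : x < l.length)
    (h : Runs w δ ω q (conf (l.set x v) M r) T Q) :
    Runs w δ ω (.seq (.assign x e) q) (conf l M r) (1 + e.cost + T) Q :=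
  (Runs.assign hv hx h).seq

theorem Runs.random {x : ℕ} (hx : x < l.length) (h : Q (conf (l.set x (ω r)) M (r + 1))) :
    Runs w δ ω (.random x) (conf l M r) 1 Q := by
  refine ⟨_, _, .random x _, le_rfl, ?_⟩
  simpa only [conf, update_getD hx] using h

theorem Runs.store {a : Expr} {u v : ℕ} (hu : a.eval w δ (conf l M r) = u)
    (hv : e.eval w δ (conf l M r) = v) (h : Q (conf l (Function.update M u v) r)) :
    Runs w δ ω (.store a e) (conf l M r) (1 + a.cost + e.cost) Q := by
  refine ⟨_, _, .store a e _, le_rfl, ?_⟩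
  rw [hv, hu]
  exact h

theorem Runs.store_seq {a : Expr} {u v : ℕ} (hu : a.eval w δ (conf l M r) = u)
    (hv : e.eval w δ (conf l M r) = v)
    (h : Runs w δ ω q (conf l (Function.update M u v) r) T Q) :
    Runs w δ ω (.seq (.store a e) q) (conf l M r) (1 + a.cost + e.cost + T) Q :=
  (Runs.store hu hv h).seq

end Rules

/-! ### Notation for expressions -/

instance : Add Expr := ⟨.op .add⟩
instance : Mul Expr := ⟨.op .mul⟩
instance : Div Expr := ⟨.op .div⟩
instance : Mod Expr := ⟨.op .mod⟩
instance (k : ℕ) : OfNat Expr k := ⟨.lit k⟩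

section Eval

variable (w : ℕ) (δ : ℝ) (s : State) (a b : Expr)

@[simp] theorem eval_ofNat (k : ℕ) : (no_index (OfNat.ofNat k : Expr)).eval w δ s = k % 2 ^ w := rfl
@[simp] theorem eval_lit (k : ℕ) : (Expr.lit k).eval w δ s = k % 2 ^ w := rfl
@[simp] theorem eval_leParam : (Expr.leParam a b).eval w δ s =
    open Classical in if (a.eval w δ s : ℝ) ≤ δ * (b.eval w δ s : ℝ) then 1 else 0 := rfl
@[simp] theorem eval_add : (a + b).eval w δ s = (a.eval w δ s + b.eval w δ s) % 2 ^ w := rfl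
@[simp] theorem eval_mul : (a * b).eval w δ s = (a.eval w δ s * b.eval w δ s) % 2 ^ w := rfl
@[simp] theorem eval_div : (a / b).eval w δ s = a.eval w δ s / b.eval w δ s := rfl
@[simp] theorem eval_mod : (a % b).eval w δ s = a.eval w δ s % b.eval w δ s := rfl
@[simp] theorem eval_lt : (Expr.op .lt a b).eval w δ s =
    if a.eval w δ s < b.eval w δ s then 1 else 0 := rfl
@[simp] theorem eval_eq : (Expr.op .eq a b).eval w δ s =
    if a.eval w δ s = b.eval w δ s then 1 else 0 := rfl
@[simp] theorem eval_load : (Expr.load a).eval w δ s = s.mem (a.eval w δ s) := rfl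
@[simp] theorem eval_reg (l : List ℕ) (M : ℕ → ℕ) (r x : ℕ) :
    (Expr.reg x).eval w δ (conf l M r) = l.getD x 0 := rfl
@[simp] theorem conf_mem (l : List ℕ) (M : ℕ → ℕ) (r : ℕ) : (conf l M r).mem = M := rfl

@[simp] theorem cost_ofNat (k : ℕ) : (no_index (OfNat.ofNat k : Expr)).cost = 1 := rfl
@[simp] theorem cost_lit (k : ℕ) : (Expr.lit k).cost = 1 := rfl
@[simp] theorem cost_reg (k : ℕ) : (Expr.reg k).cost = 1 := rfl
@[simp] theorem cost_load : (Expr.load a).cost = 1 + a.cost := rfl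
@[simp] theorem cost_op (o : BinOp) : (Expr.op o a b).cost = 1 + a.cost + b.cost := rfl
@[simp] theorem cost_leParam : (Expr.leParam a b).cost = 1 + a.cost + b.cost := rfl
@[simp] theorem cost_add : (a + b).cost = 1 + a.cost + b.cost := rfl
@[simp] theorem cost_mul : (a * b).cost = 1 + a.cost + b.cost := rfl
@[simp] theorem cost_div : (a / b).cost = 1 + a.cost + b.cost := rfl
@[simp] theorem cost_mod : (a % b).cost = 1 + a.cost + b.cost := rfl

end Eval

/-! ### Nearest row of a bit matrix -/

/-- The number of indices `j < m` at which the rows `a` and `b` of `V` differ. -/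
def diffCount (V : ℕ → ℕ → ℕ) (m a b : ℕ) : ℕ :=
  ∑ j ∈ Finset.range m, if V a j = V b j then 0 else 1

theorem diffCount_le (V : ℕ → ℕ → ℕ) (m a b : ℕ) : diffCount V m a b ≤ m := by
  refine (Finset.sum_le_card_nsmul _ _ 1 fun j _ => ?_).trans (by simp)
  split_ifs <;> simp

/-- The row `b` is a nearest row to the row `a` among the first `n` rows of `V`. -/
def IsNearestRow (V : ℕ → ℕ → ℕ) (n m a b : ℕ) : Prop :=
  b < n ∧ b ≠ a ∧ ∀ b' < n, b' ≠ a → diffCount V m a b ≤ diffCount V m a b'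

/-- Counts in register `15` the positions where the rows `reg 12` and `reg 14` differ. -/
def rowDiff : Prog :=
  .loop (.op .lt (.reg 13) (.reg 5))
    (.seq
      (.assign 15 (.reg 15 + .op .eq (.op .eq
        (.load (.reg 18 + .reg 12 * .reg 8 + .reg 13 * .reg 7))
        (.load (.reg 18 + .reg 14 * .reg 8 + .reg 13 * .reg 7))) 0))
      (.assign 13 (.reg 13 + 1)))

/-- Puts in register `16` a nearest row to the row `reg 12`, and its distance in register `17`. -/
def minRow : Prog :=
  .seq (.assign 17 (.reg 5 + 1)) <|
  .seq (.assign 14 0) <|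
  .loop (.op .lt (.reg 14) (.reg 0)) <|
    .seq
      (.ite (.op .eq (.reg 14) (.reg 12)) .skip <|
        .seq (.assign 15 0) <|
        .seq (.assign 13 0) <|
        .seq rowDiff <|
        .ite (.op .lt (.reg 15) (.reg 17))
          (.seq (.assign 17 (.reg 15)) (.assign 16 (.reg 14)))
          .skip)
      (.assign 14 (.reg 14 + 1))

section

variable {w : ℕ} {δ : ℝ} {ω : ℕ → Fin (2 ^ w)} {Q : State → Prop} {M : ℕ → ℕ}
  {dr n d k ℓ q m B s₁ s₂ s₃ L lo a j b c x y bs ptr h mid rr : ℕ} {V : ℕ → ℕ → ℕ}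

/-- The 23 registers keep the same roles throughout. The matrix entry `(a, j)` is stored at `bs + a
* s₂ + j * s₁`, with base and strides held in registers, so the same code reads both sketches and
raw points. -/
theorem runs_rowDiff (hm : m + 1 < 2 ^ w)
    (hV : ∀ a < n, ∀ j < m,
      bs + a * s₂ + j * s₁ < 2 ^ w ∧ M (bs + a * s₂ + j * s₁) = V a j)
    (ha : a < n) (hb : b < n)
    (hQ : Q (conf [n, d, k, ℓ, q, m, B, s₁, s₂, s₃, L, lo, a, m, b, diffCount V m a b, x, y,
      bs, ptr, h, mid, rr] M dr)) :
    Runs w δ ω rowDiff (conf [n, d, k, ℓ, q, m, B, s₁, s₂, s₃, L, lo, a, 0, b, 0, x, y,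
      bs, ptr, h, mid, rr] M dr) (m * 34 + 4) Q := by
  have hw : 1 < 2 ^ w := by omega
  refine (Runs.for (I := fun j s => s = conf [n, d, k, ℓ, q, m, B, s₁, s₂, s₃, L, lo, a, j, b,
    diffCount V j a b, x, y, bs, ptr, h, mid, rr] M dr) (T := 30) m ?_ ?_ ?_ ?_).mono ?_
    fun _ h => h
  · simp [diffCount]
  · rintro j s - rfl
    simp
  · rintro j s hj rfl
    obtain ⟨ha1, ha2⟩ := hV a ha j hj
    obtain ⟨hb1, hb2⟩ := hV b hb j hj
    have hc : diffCount V (j + 1) a b < 2 ^ w :=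
      (diffCount_le V (j + 1) a b).trans_lt (by omega)
    have hj' : j + 1 < 2 ^ w := by omega
    have hsucc : diffCount V (j + 1) a b = diffCount V j a b + if V a j = V b j then 0 else 1 :=
      Finset.sum_range_succ _ _
    refine (Runs.assign_seq (v := diffCount V (j + 1) a b) ?_ (by simp)
      (Runs.assign (v := j + 1) ?_ (by simp) ?_)).mono ?_ fun _ h => h
    · simp [Nat.mod_eq_of_lt ha1, Nat.mod_eq_of_lt hb1, ha2, hb2]
      rw [← Nat.mod_eq_of_lt hc, hsucc]
    · simp [Nat.mod_eq_of_lt hj']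
    · simp
    · simp
  · rintro s rfl
    exact hQ
  · simp

theorem runs_minRow (hn2 : 2 ≤ n) (hn : n < 2 ^ w) (hm : m + 1 < 2 ^ w)
    (hV : ∀ a < n, ∀ j < m,
      bs + a * s₂ + j * s₁ < 2 ^ w ∧ M (bs + a * s₂ + j * s₁) = V a j)
    (ha : a < n)
    (hQ : ∀ j b c best, IsNearestRow V n m a best →
      Q (conf [n, d, k, ℓ, q, m, B, s₁, s₂, s₃, L, lo, a, j, b, c, best, diffCount V m a best,
        bs, ptr, h, mid, rr] M dr)) :
    Runs w δ ω minRow (conf [n, d, k, ℓ, q, m, B, s₁, s₂, s₃, L, lo, a, j, b, c, x, y,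
      bs, ptr, h, mid, rr] M dr) (n * (m * 34 + 40) + 14) Q := by
  -- The initial minimum `m + 1` exceeds every count, so it survives only while no row other than
  -- `a` has been seen. Since `n ≥ 2`, it is gone at the end of the loop.
  refine (Runs.assign_seq (v := m + 1) (by simp [Nat.mod_eq_of_lt hm]) (by simp) <|
    Runs.assign_seq (v := 0) (by simp) (by simp) <|
    Runs.for (I := fun b' s => ∃ j c x y, s = conf [n, d, k, ℓ, q, m, B, s₁, s₂, s₃, L, lo, a, j,
      b', c, x, y, bs, ptr, h, mid, rr] M dr ∧ (∀ b < b', b ≠ a → y ≤ diffCount V m a b) ∧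
      (y = m + 1 ∨ x < b' ∧ x ≠ a ∧ diffCount V m a x = y))
      (T := m * 34 + 36) n ?_ ?_ ?_ ?_).mono ?_ fun _ h => h
  · exact ⟨j, c, x, m + 1, by simp, by simp, .inl rfl⟩
  · rintro b' s - ⟨j, c, x, y, rfl, -⟩
    simp
  · rintro b' s hb' ⟨j, c, x, y, rfl, hy, hx⟩
    have hb1 : b' + 1 < 2 ^ w := by omega
    have hlast : ∀ j c x y, (∀ b < b' + 1, b ≠ a → y ≤ diffCount V m a b) →
        (y = m + 1 ∨ x < b' + 1 ∧ x ≠ a ∧ diffCount V m a x = y) →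
        Runs w δ ω (.assign 14 (.reg 14 + 1)) (conf [n, d, k, ℓ, q, m, B, s₁, s₂, s₃, L, lo, a, j,
          b', c, x, y, bs, ptr, h, mid, rr] M dr) 4 fun s => ∃ j c x y, s = conf [n, d, k, ℓ, q, m,
          B, s₁, s₂, s₃, L, lo, a, j, b' + 1, c, x, y, bs, ptr, h, mid, rr] M dr ∧
          (∀ b < b' + 1, b ≠ a → y ≤ diffCount V m a b) ∧
          (y = m + 1 ∨ x < b' + 1 ∧ x ≠ a ∧ diffCount V m a x = y) := by
      intro j c x y h1 h2
      exact Runs.assign (v := b' + 1) (by simp [Nat.mod_eq_of_lt hb1]) (by simp)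
        ⟨j, c, x, y, by simp, h1, h2⟩
    refine (Runs.seq (T := m * 34 + 32) (T' := 4) ?_).mono (by omega) fun _ h => h
    by_cases hba : b' = a
    · refine (Runs.ite_true (by simp [hba]) <| Runs.skip <| hlast j c x y ?_ ?_).mono
        (by simp) fun _ h => h
      · intro b hb hne
        exact hy b (by omega) hne
      · rcases hx with hx | hx
        · exact .inl hx
        · exact .inr ⟨by omega, hx.2⟩
    · refine (Runs.ite_false (by simp [hba]) <|
        Runs.assign_seq (v := 0) (by simp) (by simp) <|
        Runs.assign_seq (v := 0) (by simp) (by simp) <|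
        Runs.seq (T' := 9) <| runs_rowDiff hm hV ha hb' ?_).mono
        (by simp; omega) fun _ h => h
      by_cases hlt : diffCount V m a b' < y
      · refine (Runs.ite_true (by simp [hlt]) <| Runs.assign_seq (v := diffCount V m a b')
          (by simp) (by simp) <| Runs.assign (v := b') (by simp) (by simp) <|
          hlast _ _ _ _ ?_ ?_).mono (by simp) fun _ h => h
        · intro b hb hne
          rcases Nat.lt_succ_iff_lt_or_eq.1 hb with hb | rfl
          · exact hlt.le.trans (hy b hb hne)
          · exact le_rfl
        · exact .inr ⟨by omega, hba, rfl⟩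
      · refine (Runs.ite_false (by simp [hlt]) <| Runs.skip <| hlast _ _ _ _ ?_ ?_).mono
          (by simp) fun _ h => h
        · intro b hb hne
          rcases Nat.lt_succ_iff_lt_or_eq.1 hb with hb | rfl
          · exact hy b hb hne
          · omega
        · rcases hx with hx | hx
          · exact .inl hx
          · exact .inr ⟨by omega, hx.2⟩
  · rintro s ⟨j, c, x, y, rfl, hy, hx⟩
    rcases hx with rfl | ⟨hx, hxa, rfl⟩
    · exfalso
      obtain ⟨b, hb, hba⟩ : ∃ b < n, b ≠ a := by
        rcases Nat.eq_zero_or_pos a with rfl | h0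
        · exact ⟨1, by omega, by omega⟩
        · exact ⟨0, by omega, by omega⟩
      have h1 := hy b hb hba
      have h2 := diffCount_le V m a b
      omega
    · exact hQ j n c x ⟨hx, hxa, hy⟩
  · simp
    ring_nf
    omega

end

/-! ### Binary search for the scale -/

/-- At the scale `i`, every row differs from the row `a` in at least `3 / 32` of the positions. -/
def IsFar (V : ℕ → ℕ → ℕ → ℕ) (n m i a : ℕ) : Prop :=
  ∀ b < n, b ≠ a → 3 * m ≤ 32 * diffCount (V i) m a b

/-- A lower bound for the smallest count is a lower bound for all of them, so one nearest-row
computation decides whether a scale is far. -/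
theorem IsNearestRow.isFar_iff {V : ℕ → ℕ → ℕ → ℕ} {n m i a b : ℕ}
    (h : IsNearestRow (V i) n m a b) :
    IsFar V n m i a ↔ ¬ 32 * diffCount (V i) m a b < 3 * m := by
  rw [not_lt]
  refine ⟨fun H => H b h.1 h.2.1, fun H b' hb' hne => H.trans ?_⟩
  exact Nat.mul_le_mul_left _ (h.2.2 b' hb' hne)

/-- The row `b` is a nearest row to `a` at a scale where `IsFar` changes from true to false. -/
def IsSelected (V : ℕ → ℕ → ℕ → ℕ) (n m L a b : ℕ) : Prop :=
  ∃ i < L, IsNearestRow (V i) n m a b ∧ (i = 0 ∨ IsFar V n m i a) ∧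
    (i + 1 = L ∨ ¬ IsFar V n m (i + 1) a)

/-- Binary search, for the row `reg 12`, for a scale where `IsFar` changes. -/
def scaleSearch : Prog :=
  .loop (.op .lt (.reg 11 + 1) (.reg 20)) <|
    .seq (.assign 21 ((.reg 11 + .reg 20) / 2)) <|
    .seq (.assign 18 (.reg 6 + .reg 21 * .reg 9)) <|
    .seq minRow <|
    .ite (.op .lt (32 * .reg 17) (3 * .reg 5)) (.assign 20 (.reg 21)) (.assign 11 (.reg 21))

/-- Writes the index of a selected row for every row. -/
def selectAll : Prog :=
  .loop (.op .lt (.reg 12) (.reg 0)) <|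
    .seq (.assign 11 0) <|
    .seq (.assign 20 (.reg 10)) <|
    .seq scaleSearch <|
    .seq (.assign 18 (.reg 6 + .reg 11 * .reg 9)) <|
    .seq minRow <|
    .seq (.store (.reg 0 * .reg 1 + .reg 12) (.reg 16)) <|
    .assign 12 (.reg 12 + 1)

section

variable {w : ℕ} {δ : ℝ} {ω : ℕ → Fin (2 ^ w)} {Q : State → Prop} {M : ℕ → ℕ}
  {dr n d k ℓ q m B s₁ s₂ s₃ L lo a j b c x y bs ptr h mid rr : ℕ} {V : ℕ → ℕ → ℕ → ℕ}

/-- The search needs no monotonicity of `IsFar` in the scale: it keeps `lo` far and `h` not far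
while the length bound for the interval halves. The ends `0` and `L` have these properties by
convention and are never tested, which is why they appear as alternatives in the conclusion. -/
theorem runs_scaleSearch (hn2 : 2 ≤ n) (hn : n < 2 ^ w) (hm : 32 * (m + 1) < 2 ^ w)
    (hm0 : 0 < m) (hL0 : 0 < L) (hL : 2 * L < 2 ^ w)
    (hV : ∀ i < L, ∀ a < n, ∀ j < m, B + i * s₃ + a * s₂ + j * s₁ < 2 ^ w ∧
      M (B + i * s₃ + a * s₂ + j * s₁) = V i a j)
    (ha : a < n)
    (hQ : ∀ lo j b c x y bs h mid, lo < L → (lo = 0 ∨ IsFar V n m lo a) →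
      (lo + 1 = L ∨ ¬ IsFar V n m (lo + 1) a) →
      Q (conf [n, d, k, ℓ, q, m, B, s₁, s₂, s₃, L, lo, a, j, b, c, x, y, bs, ptr, h, mid, rr]
        M dr)) :
    Runs w δ ω scaleSearch
      (conf [n, d, k, ℓ, q, m, B, s₁, s₂, s₃, L, 0, a, j, b, c, x, y, bs, ptr, L, mid, rr] M dr)
      (Nat.clog 2 L * (n * (m * 34 + 40) + 42) + 6) Q := by
  set N := Nat.clog 2 L
  refine (Runs.loop (I := fun r s => ∃ lo h j b c x y bs mid,
    s = conf [n, d, k, ℓ, q, m, B, s₁, s₂, s₃, L, lo, a, j, b, c, x, y, bs, ptr, h, mid, rr] M dr ∧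
    lo < h ∧ h ≤ L ∧ h ≤ lo + 2 ^ (N - r) ∧ (lo = 0 ∨ IsFar V n m lo a) ∧
    (h = L ∨ ¬ IsFar V n m h a)) (T := n * (m * 34 + 40) + 36) N ?_ ?_ ?_).mono
    (by simp; apply le_of_eq; ring) fun _ h => h
  · refine ⟨0, L, j, b, c, x, y, bs, mid, rfl, hL0, le_rfl, ?_, .inl rfl, .inl rfl⟩
    simpa using Nat.le_pow_clog (by norm_num) L
  · rintro r s ⟨lo, h, j, b, c, x, y, bs, mid, rfl, h1, h2, h3, h4, h5⟩ he
    have h1' : lo + 1 < 2 ^ w := by omega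
    have : h = lo + 1 := by
      simp [Nat.mod_eq_of_lt h1'] at he
      omega
    subst this
    exact hQ _ _ _ _ _ _ _ _ _ (by omega) h4 h5
  · rintro r s ⟨lo, h, j, b, c, x, y, bs, mid, rfl, h1, h2, h3, h4, h5⟩ he
    have h1' : lo + 1 < 2 ^ w := by omega
    have hlt : lo + 1 < h := by
      simp [Nat.mod_eq_of_lt h1'] at he
      omega
    have hr : r < N := by
      by_contra hr
      have : N - r = 0 := by omega
      rw [this] at h3
      omega
    refine ⟨hr, ?_⟩
    have hpow : 2 ^ (N - r) = 2 * 2 ^ (N - (r + 1)) := by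
      rw [← pow_succ']
      congr 1
      omega
    have hsum : lo + h < 2 ^ w := by omega
    have hw2 : 2 < 2 ^ w := by omega
    have hmid : (lo + h) / 2 < L := by omega
    obtain ⟨g, hg⟩ : ∃ g, g = (lo + h) / 2 := ⟨_, rfl⟩
    rw [← hg] at hmid
    have hB : B + g * s₃ < 2 ^ w := by
      have := (hV g hmid 0 (by omega) 0 hm0).1
      omega
    refine (Runs.assign_seq (v := g) (by simp [Nat.mod_eq_of_lt hsum, Nat.mod_eq_of_lt hw2, hg])
      (by simp) <|
      Runs.assign_seq (v := B + g * s₃) (by simp [Nat.mod_eq_of_lt hB]) (by simp) <|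
      Runs.seq (T' := 10) <| runs_minRow hn2 hn (by omega) (hV g hmid) ha ?_).mono
      (by simp; omega) fun _ h => h
    intro j b c best hbest
    have hle := diffCount_le (V g) m a best
    have hc1 : 32 * diffCount (V g) m a best < 2 ^ w := by omega
    have hc2 : 3 * m < 2 ^ w := by omega
    have hfar := hbest.isFar_iff
    by_cases hlt : 32 * diffCount (V g) m a best < 3 * m
    · refine (Runs.ite_true (by simp [Nat.mod_eq_of_lt hc1, Nat.mod_eq_of_lt hc2, hlt]) <|
        Runs.assign (v := g) (by simp) (by simp) ?_).mono (by simp) fun _ h => h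
      exact ⟨lo, g, j, b, c, best, _, _, g, by simp; rfl, by omega, by omega, by omega, h4,
        .inr (by simp [hfar, hlt])⟩
    · refine (Runs.ite_false (by simp [Nat.mod_eq_of_lt hc1, Nat.mod_eq_of_lt hc2, hlt]) <|
        Runs.assign (v := g) (by simp) (by simp) ?_).mono (by simp) fun _ h => h
      exact ⟨g, h, j, b, c, best, _, _, g, by simp; rfl, by omega, by omega, by omega,
        .inr (hfar.2 hlt), h5⟩

/-- The output goes to the cells from `n * d` up to `n * d + n`. The matrix has to avoid them: raw
points lie below, sketches above. -/
theorem runs_selectAll (hn2 : 2 ≤ n) (hm : 32 * (m + 1) < 2 ^ w)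
    (hm0 : 0 < m) (hL0 : 0 < L) (hL : 2 * L < 2 ^ w) (hnd : n * d + n < 2 ^ w)
    (hV : ∀ i < L, ∀ a < n, ∀ j < m, B + i * s₃ + a * s₂ + j * s₁ < 2 ^ w ∧
      (B + i * s₃ + a * s₂ + j * s₁ < n * d ∨ n * d + n ≤ B + i * s₃ + a * s₂ + j * s₁) ∧
      M (B + i * s₃ + a * s₂ + j * s₁) = V i a j)
    (hQ : ∀ s : State, (∀ a < n, IsSelected V n m L a (s.mem (n * d + a))) → Q s) :
    Runs w δ ω selectAll
      (conf [n, d, k, ℓ, q, m, B, s₁, s₂, s₃, L, lo, 0, j, b, c, x, y, bs, ptr, h, mid, rr] M dr)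
      (n * (Nat.clog 2 L * (n * (m * 34 + 40) + 42) + (n * (m * 34 + 40) + 45)) + 4) Q := by
  have hn : n < 2 ^ w := by omega
  refine (Runs.for (I := fun a s => ∃ M' lo j b c x y bs h mid,
    s = conf [n, d, k, ℓ, q, m, B, s₁, s₂, s₃, L, lo, a, j, b, c, x, y, bs, ptr, h, mid, rr]
      M' dr ∧ (∀ A, (A < n * d ∨ n * d + n ≤ A) → M' A = M A) ∧
      ∀ a' < a, IsSelected V n m L a' (M' (n * d + a')))
      (T := Nat.clog 2 L * (n * (m * 34 + 40) + 42) + (n * (m * 34 + 40) + 41)) n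
      ?_ ?_ ?_ ?_).mono ?_ fun _ h => h
  · exact ⟨M, lo, j, b, c, x, y, bs, h, mid, rfl, fun _ _ => rfl, by simp⟩
  · rintro a s - ⟨M', lo, j, b, c, x, y, bs, h, mid, rfl, -⟩
    simp
  · rintro a s ha ⟨M', lo, j, b, c, x, y, bs, h, mid, rfl, hM, hsel⟩
    have hV' : ∀ i < L, ∀ a < n, ∀ j < m, B + i * s₃ + a * s₂ + j * s₁ < 2 ^ w ∧
        M' (B + i * s₃ + a * s₂ + j * s₁) = V i a j := fun i hi a ha j hj =>
      have H := hV i hi a ha j hj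
      ⟨H.1, (hM _ H.2.1).trans H.2.2⟩
    refine (Runs.assign_seq (v := 0) (by simp) (by simp) <|
      Runs.assign_seq (v := L) (by simp) (by simp) <|
      Runs.seq (T' := n * (m * 34 + 40) + 31) <|
      runs_scaleSearch hn2 hn hm hm0 hL0 hL hV' ha ?_).mono (by simp; omega) fun _ h => h
    intro i j b c x y bs h mid hi hfar hfar'
    have hB : B + i * s₃ < 2 ^ w := by
      have := (hV i hi 0 (by omega) 0 hm0).1
      omega
    refine (Runs.assign_seq (v := B + i * s₃) (by simp [Nat.mod_eq_of_lt hB]) (by simp) <|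
      Runs.seq (T' := 11) <| runs_minRow hn2 hn (by omega) (hV' i hi) ha ?_).mono
      (by simp; omega) fun _ h => h
    intro j b c best hbest
    have hst : n * d + a < 2 ^ w := by omega
    have ha1 : a + 1 < 2 ^ w := by omega
    refine (Runs.store_seq (u := n * d + a) (v := best) (by simp [Nat.mod_eq_of_lt hst])
      (by simp) <| Runs.assign (v := a + 1) (by simp [Nat.mod_eq_of_lt ha1]) (by simp) ?_).mono
      (by simp) fun _ h => h
    refine ⟨_, i, j, b, c, best, _, _, h, mid, by simp; rfl, ?_, ?_⟩
    · intro A hA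
      rw [Function.update_of_ne (by omega), hM A hA]
    · intro a' ha'
      by_cases h' : a' = a
      · subst h'
        rw [Function.update_self]
        exact ⟨i, hi, hbest, hfar, hfar'⟩
      · rw [Function.update_of_ne (by omega)]
        exact hsel a' (by omega)
  · rintro s ⟨M', lo, j, b, c, x, y, bs, h, mid, rfl, hM, hsel⟩
    exact hQ _ hsel
  · simp
    apply le_of_eq
    ring

end

/-! ### Random parity sketches -/

/-- The random bit which is `1` if the random word with index `u` is divisible by `g`. -/
def randBit {w : ℕ} (ω : ℕ → Fin (2 ^ w)) (g u : ℕ) : ℕ :=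
  if (ω u : ℕ) % g = 0 then 1 else 0

/-- The parity of the row `a` of `X` on the random set of coordinates given by the random bits
with indices `u, …, u + d - 1`. -/
def sketchBit {w : ℕ} (X : ℕ → ℕ) (ω : ℕ → Fin (2 ^ w)) (d g u a : ℕ) : ℕ :=
  (∑ t ∈ Finset.range d, X (a * d + t) * randBit ω g (u + t)) % 2

/-- Writes `d` random bits. -/
def fillRandom : Prog :=
  .loop (.op .lt (.reg 14) (.reg 1)) <|
    .seq (.random 22) <|
    .seq (.store (.reg 0 * .reg 1 + .reg 0 + .reg 14) (.op .eq (.reg 22 % .reg 4) 0)) <|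
    .assign 14 (.reg 14 + 1)

/-- Computes in register `15` the parity of the row `reg 12` on the random coordinates. -/
def rowParity : Prog :=
  .loop (.op .lt (.reg 14) (.reg 1)) <|
    .seq (.assign 15 ((.reg 15 + .load (.reg 12 * .reg 1 + .reg 14) *
      .load (.reg 0 * .reg 1 + .reg 0 + .reg 14)) % 2)) <|
    .assign 14 (.reg 14 + 1)

/-- Writes the parities of all rows. -/
def allParities : Prog :=
  .loop (.op .lt (.reg 12) (.reg 0)) <|
    .seq (.assign 14 0) <|
    .seq (.assign 15 0) <|
    .seq rowParity <|
    .seq (.store (.reg 19) (.reg 15)) <|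
    .seq (.assign 19 (.reg 19 + 1)) <|
    .assign 12 (.reg 12 + 1)

/-- Writes one sketch bit for every row. -/
def sketchStep : Prog :=
  .seq (.assign 14 0) <|
  .seq fillRandom <|
  .seq (.assign 12 0) allParities

/-- Writes the sketches of all rows at all scales. -/
def sketchAll : Prog :=
  .loop (.op .lt (.reg 4) (16 * .reg 1)) <|
    .seq (.assign 4 (2 * .reg 4)) <|
    .seq (.assign 13 0) <|
    .seq (.loop (.op .lt (.reg 13) (.reg 5)) (.seq sketchStep (.assign 13 (.reg 13 + 1)))) <|
    .assign 10 (.reg 10 + 1)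

section

variable {w : ℕ} {δ : ℝ} {ω : ℕ → Fin (2 ^ w)} {Q : State → Prop} {M X : ℕ → ℕ}
  {dr n d k ℓ q m B s₁ s₂ s₃ L lo a j b c x y bs ptr h mid rr : ℕ}

theorem runs_fillRandom (hnd : n * d + n + d < 2 ^ w)
    (hQ : ∀ M' rr, (∀ A, (A < n * d + n ∨ n * d + n + d ≤ A) → M' A = M A) →
      (∀ t < d, M' (n * d + n + t) = randBit ω q (dr + t)) →
      Q (conf [n, d, k, ℓ, q, m, B, s₁, s₂, s₃, L, lo, a, j, d, c, x, y, bs, ptr, h, mid, rr]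
        M' (dr + d))) :
    Runs w δ ω fillRandom
      (conf [n, d, k, ℓ, q, m, B, s₁, s₂, s₃, L, lo, a, j, 0, c, x, y, bs, ptr, h, mid, rr] M dr)
      (d * 22 + 4) Q := by
  refine (Runs.for (I := fun t s => ∃ M' rr, s = conf [n, d, k, ℓ, q, m, B, s₁, s₂, s₃, L, lo, a, j,
    t, c, x, y, bs, ptr, h, mid, rr] M' (dr + t) ∧
    (∀ A, (A < n * d + n ∨ n * d + n + d ≤ A) → M' A = M A) ∧
    ∀ t' < t, M' (n * d + n + t') = randBit ω q (dr + t')) (T := 18) d ?_ ?_ ?_ ?_).mono ?_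
    fun _ h => h
  · exact ⟨M, rr, rfl, fun _ _ => rfl, by simp⟩
  · rintro t s - ⟨M', rr, rfl, -⟩
    simp
  · rintro t s ht ⟨M', rr, rfl, hM, hr⟩
    have h1 : n * d + n + t < 2 ^ w := by omega
    have h2 : t + 1 < 2 ^ w := by omega
    refine (Runs.seq (T' := 17) <| Runs.random (by simp) <|
      (Runs.store_seq (u := n * d + n + t) (v := randBit ω q (dr + t))
        (by simp [Nat.mod_eq_of_lt h1]) (by simp [randBit]) <|
      Runs.assign (v := t + 1) (by simp [Nat.mod_eq_of_lt h2]) (by simp) ?_).mono (by simp)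
        fun _ h => h).mono (by simp) fun _ h => h
    refine ⟨_, _, by simp; rfl, fun A hA => ?_, fun t' ht' => ?_⟩
    · rw [Function.update_of_ne (by omega), hM A hA]
    · by_cases h' : t' = t
      · subst h'
        rw [Function.update_self]
      · rw [Function.update_of_ne (by omega)]
        exact hr t' (by omega)
  · rintro s ⟨M', rr, rfl, hM, hr⟩
    exact hQ M' rr hM hr
  · simp

theorem runs_rowParity {u : ℕ} (hnd : n * d + n + d < 2 ^ w)
    (hX : ∀ A < n * d, M A = X A) (hR : ∀ t < d, M (n * d + n + t) = randBit ω q (u + t))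
    (ha : a < n)
    (hQ : Q (conf [n, d, k, ℓ, q, m, B, s₁, s₂, s₃, L, lo, a, j, d, sketchBit X ω d q u a, x, y,
      bs, ptr, h, mid, rr] M dr)) :
    Runs w δ ω rowParity
      (conf [n, d, k, ℓ, q, m, B, s₁, s₂, s₃, L, lo, a, j, 0, 0, x, y, bs, ptr, h, mid, rr] M dr)
      (d * 28 + 4) Q := by
  refine (Runs.for (I := fun t s => s = conf [n, d, k, ℓ, q, m, B, s₁, s₂, s₃, L, lo, a, j,
    t, (∑ t ∈ Finset.range t, X (a * d + t) * randBit ω q (u + t)) % 2, x, y, bs, ptr, h, mid, rr]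
    M dr) (T := 24) d ?_ ?_ ?_ ?_).mono ?_ fun _ h => h
  · simp
  · rintro t s - rfl
    simp
  · rintro t s ht rfl
    have had : a * d + t < n * d := by
      calc a * d + t < (a + 1) * d := by rw [add_mul, one_mul]; omega
        _ ≤ n * d := Nat.mul_le_mul_right _ ha
    have h1 : n * d + n + t < 2 ^ w := by omega
    have h2 : t + 1 < 2 ^ w := by omega
    have h3 : a * d + t < 2 ^ w := by omega
    -- Reduction modulo `2 ^ w` preserves parity, so overflow in the accumulation is harmless.
    have hw : 2 ∣ 2 ^ w := dvd_pow_self _ (by rintro rfl; omega)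
    have hw2 : 2 < 2 ^ w := by
      have : 2 ≤ n * d + n + d := by
        have := Nat.mul_pos (show 0 < n by omega) (show 0 < d by omega)
        omega
      omega
    refine (Runs.assign_seq
      (v := (∑ t ∈ Finset.range (t + 1), X (a * d + t) * randBit ω q (u + t)) % 2) ?_ (by simp) <|
      Runs.assign (v := t + 1) (by simp [Nat.mod_eq_of_lt h2]) (by simp) ?_).mono (by simp)
        fun _ h => h
    · simp [Nat.mod_eq_of_lt h1, Nat.mod_eq_of_lt h3, Nat.mod_eq_of_lt hw2, hX _ had, hR t ht,
        Nat.mod_mod_of_dvd _ hw, Finset.sum_range_succ]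
    · simp
  · rintro s rfl
    exact hQ
  · simp

theorem runs_allParities {u : ℕ} (hnd : n * d + n + d < 2 ^ w) (hptr : ptr + n < 2 ^ w)
    (hptr' : n * d + n + d ≤ ptr)
    (hX : ∀ A < n * d, M A = X A) (hR : ∀ t < d, M (n * d + n + t) = randBit ω q (u + t))
    (hQ : ∀ M' a b c, (∀ A < ptr, M' A = M A) →
      (∀ a < n, M' (ptr + a) = sketchBit X ω d q u a) →
      Q (conf [n, d, k, ℓ, q, m, B, s₁, s₂, s₃, L, lo, a, j, b, c, x, y, bs, ptr + n, h, mid, rr]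
        M' dr)) :
    Runs w δ ω allParities
      (conf [n, d, k, ℓ, q, m, B, s₁, s₂, s₃, L, lo, 0, j, b, c, x, y, bs, ptr, h, mid, rr] M dr)
      (n * (d * 28 + 23) + 4) Q := by
  refine (Runs.for (I := fun a s => ∃ M' b c, s = conf [n, d, k, ℓ, q, m, B, s₁, s₂, s₃, L, lo, a,
    j, b, c, x, y, bs, ptr + a, h, mid, rr] M' dr ∧ (∀ A < ptr, M' A = M A) ∧
    ∀ a' < a, M' (ptr + a') = sketchBit X ω d q u a') (T := d * 28 + 19) n ?_ ?_ ?_ ?_).mono ?_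
    fun _ h => h
  · exact ⟨M, b, c, rfl, fun _ _ => rfl, by simp⟩
  · rintro a s - ⟨M', b, c, rfl, -⟩
    simp
  · rintro a s ha ⟨M', b, c, rfl, hM, hs⟩
    have h1 : ptr + a + 1 < 2 ^ w := by omega
    have h2 : a + 1 < 2 ^ w := by omega
    refine (Runs.assign_seq (v := 0) (by simp) (by simp) <|
      Runs.assign_seq (v := 0) (by simp) (by simp) <|
      Runs.seq (T' := 11) <| runs_rowParity hnd
        (fun A hA => (hM A (by omega)).trans (hX A hA))
        (fun t ht => (hM _ (by omega)).trans (hR t ht)) ha <|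
      (Runs.store_seq (u := ptr + a) (v := sketchBit X ω d q u a) (by simp) (by simp) <|
      Runs.assign_seq (v := ptr + a + 1) (by simp [Nat.mod_eq_of_lt h1]) (by simp) <|
      Runs.assign (v := a + 1) (by simp [Nat.mod_eq_of_lt h2]) (by simp) ?_).mono (by simp)
        fun _ h => h).mono (by simp; omega) fun _ h => h
    refine ⟨_, _, _, by simp [add_assoc]; rfl, fun A hA => ?_, fun a' ha' => ?_⟩
    · rw [Function.update_of_ne (by omega), hM A hA]
    · by_cases h' : a' = a
      · subst h'
        rw [Function.update_self]
      · rw [Function.update_of_ne (by omega)]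
        exact hs a' (by omega)
  · rintro s ⟨M', b, c, rfl, hM, hs⟩
    exact hQ M' _ _ _ hM hs
  · simp
    apply le_of_eq
    ring

theorem runs_sketchStep (hnd : n * d + n + d < 2 ^ w) (hptr : ptr + n < 2 ^ w)
    (hptr' : n * d + n + d ≤ ptr) (hX : ∀ A < n * d, M A = X A)
    (hQ : ∀ M' a b c rr, (∀ A, (A < n * d + n ∨ n * d + n + d ≤ A ∧ A < ptr) → M' A = M A) →
      (∀ a < n, M' (ptr + a) = sketchBit X ω d q dr a) →
      Q (conf [n, d, k, ℓ, q, m, B, s₁, s₂, s₃, L, lo, a, j, b, c, x, y, bs, ptr + n, h, mid, rr]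
        M' (dr + d))) :
    Runs w δ ω sketchStep
      (conf [n, d, k, ℓ, q, m, B, s₁, s₂, s₃, L, lo, a, j, b, c, x, y, bs, ptr, h, mid, rr] M dr)
      (d * 22 + n * (d * 28 + 23) + 12) Q := by
  refine (Runs.assign_seq (v := 0) (by simp) (by simp) <|
    Runs.seq (T' := n * (d * 28 + 23) + 6) <| runs_fillRandom hnd fun M₁ rr hM₁ hr =>
    (Runs.assign_seq (v := 0) (by simp) (by simp) <|
    runs_allParities hnd hptr hptr' (fun A hA => (hM₁ A (by omega)).trans (hX A hA)) hr
      fun M₂ a b c hM₂ hs => ?_).mono (by simp; omega) fun _ h => h).mono (by simp; omega)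
    fun _ h => h
  exact hQ M₂ a b c rr (fun A hA => (hM₂ A (by omega)).trans (hM₁ A (by omega))) hs

/-- The first `g` groups of sketch bits have been written, `m` groups for each scale. -/
def Sketched (ω : ℕ → Fin (2 ^ w)) (X : ℕ → ℕ) (n d m g : ℕ) (M : ℕ → ℕ) : Prop :=
  (∀ A < n * d, M A = X A) ∧ ∀ i, ∀ j < m, ∀ a < n, i * m + j < g →
    M (n * d + n + d + (i * m + j) * n + a) = sketchBit X ω d (2 ^ (i + 1)) ((i * m + j) * d) a

/-- Groups occupy consecutive blocks of `n` cells, so writing a new block leaves the older ones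
intact. Division by `m` recovers the scale from the number of a group. -/
theorem Sketched.step {i : ℕ} {M' : ℕ → ℕ} (hM : Sketched ω X n d m (i * m + j) M) (hj : j < m)
    (h1 : ∀ A, (A < n * d + n ∨ n * d + n + d ≤ A ∧ A < n * d + n + d + (i * m + j) * n) →
      M' A = M A)
    (h2 : ∀ a < n, M' (n * d + n + d + (i * m + j) * n + a) =
      sketchBit X ω d (2 ^ (i + 1)) ((i * m + j) * d) a) :
    Sketched ω X n d m (i * m + (j + 1)) M' := by
  refine ⟨fun A hA => (h1 A (by omega)).trans (hM.1 A hA), fun i' j' hj' a ha hlt => ?_⟩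
  by_cases heq : i' * m + j' = i * m + j
  · have hi : i' = i := by
      have h := congrArg (· / m) heq
      simpa [Nat.add_div_of_dvd_right (Nat.dvd_mul_left _ _), Nat.div_eq_of_lt hj,
        Nat.div_eq_of_lt hj', Nat.mul_div_cancel _ (Nat.zero_lt_of_lt hj)] using h
    rw [heq, hi]
    exact h2 a ha
  · have hlt' : i' * m + j' + 1 ≤ i * m + j := by omega
    have := Nat.mul_le_mul_right n hlt'
    rw [add_mul, one_mul] at this
    rw [h1 _ (by omega), hM.2 i' j' hj' a ha (by omega)]

/-- The invariant ties the number of draws to the group number: group `i * m + j` uses exactly the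
`d` random words starting at index `(i * m + j) * d`. Distinct groups therefore use disjoint blocks
of words, the source of independence later on. -/
theorem runs_sketchAll (hd : 0 < d)
    (hw : n * d + n + d + (Nat.clog 2 (16 * d) * m + 1) * (n + 1) < 2 ^ w) (hw' : 32 * d < 2 ^ w)
    (hX : ∀ A < n * d, M A = X A)
    (hQ : ∀ M' q a j b c ptr rr dr, Sketched ω X n d m (Nat.clog 2 (16 * d) * m) M' →
      Q (conf [n, d, k, ℓ, q, m, B, s₁, s₂, s₃, Nat.clog 2 (16 * d), lo, a, j, b, c, x, y, bs, ptr,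
        h, mid, rr] M' dr)) :
    Runs w δ ω sketchAll
      (conf [n, d, k, ℓ, 1, m, B, s₁, s₂, s₃, 0, lo, a, j, b, c, x, y, bs,
        n * d + n + d, h, mid, rr] M 0)
      (Nat.clog 2 (16 * d) * (m * (d * 22 + n * (d * 28 + 23) + 20) + 20) + 6) Q := by
  set N := Nat.clog 2 (16 * d)
  have hpow : ∀ i, 2 ^ i < 16 * d ↔ i < N := fun i => (Nat.lt_clog_iff_pow_lt (by norm_num)).symm
  have hd16 : 16 * d < 2 ^ w := by omega
  have hw2 : 16 < 2 ^ w := by omega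
  have hw1 : 2 < 2 ^ w := by omega
  have hNw : (N * m + 1) * (n + 1) = N * m * n + N * m + n + 1 := by ring
  refine (Runs.for (I := fun i s => ∃ M' a j b c rr, s = conf [n, d, k, ℓ, 2 ^ i, m, B, s₁, s₂, s₃,
    i, lo, a, j, b, c, x, y, bs, n * d + n + d + i * m * n, h, mid, rr] M' (i * m * d) ∧
    Sketched ω X n d m (i * m) M') (T := m * (d * 22 + n * (d * 28 + 23) + 20) + 14)
    N ?_ ?_ ?_ ?_).mono ?_ fun _ h => h
  · exact ⟨M, a, j, b, c, rr, by simp, hX, by simp⟩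
  · rintro i s - ⟨M', a, j, b, c, rr, rfl, -⟩
    simp [Nat.mod_eq_of_lt hd16, Nat.mod_eq_of_lt hw2, hpow]
  · rintro i s hi ⟨M', a, j, b, c, rr, rfl, hS⟩
    have h2i : 2 ^ i * 2 < 2 ^ w := by
      have := (hpow i).2 hi
      omega
    have hi1 : i + 1 < 2 ^ w := by
      have : i < 2 ^ i := Nat.lt_two_pow_self
      omega
    refine (Runs.assign_seq (v := 2 ^ (i + 1))
      (by simp [pow_succ, mul_comm 2, Nat.mod_eq_of_lt hw1, Nat.mod_eq_of_lt h2i]) (by simp) <|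
      Runs.assign_seq (v := 0) (by simp) (by simp) <|
      Runs.seq (T := m * (d * 22 + n * (d * 28 + 23) + 20) + 4) (T' := 4) <|
      (Runs.for (I := fun j s => ∃ M' a b c rr, s = conf [n, d, k, ℓ, 2 ^ (i + 1), m, B, s₁, s₂,
        s₃, i, lo, a, j, b, c, x, y, bs, n * d + n + d + (i * m + j) * n, h, mid, rr] M'
        ((i * m + j) * d) ∧ Sketched ω X n d m (i * m + j) M')
        (T := d * 22 + n * (d * 28 + 23) + 16) m ?_ ?_ ?_ ?_).mono (by simp; apply le_of_eq; ring)
        fun _ h => h).mono (by simp; omega) fun _ h => h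
    · exact ⟨M', a, b, c, rr, by simp, hS⟩
    · rintro j s - ⟨M', a, b, c, rr, rfl, -⟩
      simp
    · rintro j s hj ⟨M', a, b, c, rr, rfl, hS⟩
      have hle : (i * m + j + 1) * n ≤ N * m * n := by
        refine Nat.mul_le_mul_right n ?_
        calc i * m + j + 1 ≤ (i + 1) * m := by rw [add_mul, one_mul]; omega
          _ ≤ N * m := Nat.mul_le_mul_right m hi
      rw [add_mul, one_mul] at hle
      have hj1 : j + 1 < 2 ^ w := by
        have : m ≤ N * m := Nat.le_mul_of_pos_left m (by omega)
        omega
      refine (Runs.seq (T' := 4) <| runs_sketchStep (by omega) (by omega) (by omega) hS.1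
        fun M₁ a b c rr h1 h2 => ?_).mono (by omega) fun _ h => h
      exact Runs.assign (v := j + 1) (by simp [Nat.mod_eq_of_lt hj1]) (by simp)
        ⟨M₁, a, b, c, rr, by simp [add_mul, add_assoc], hS.step hj h1 h2⟩
    · rintro s ⟨M', a, b, c, rr, rfl, hS⟩
      refine Runs.assign (v := i + 1) (by simp [Nat.mod_eq_of_lt hi1]) (by simp)
        ⟨M', a, m, b, c, rr, by simp [add_mul, add_assoc], ?_⟩
      rwa [add_mul, one_mul]
  · rintro s ⟨M', a, j, b, c, rr, rfl, hS⟩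
    exact hQ _ _ _ _ _ _ _ _ _ hS
  · simp
    apply le_of_eq
    ring

end

/-! ### The program -/

/-- Searches for the least `k ≤ d + 1` with `1 ≤ δ k` or `d < k`. -/
def paramSearch : Prog :=
  .loop (.op .eq (.leParam 1 (.reg 2) + .op .lt (.reg 1) (.reg 2)) 0) (.assign 2 (.reg 2 + 1))

/-- Computes in register `3` the logarithm of `n * d` to base two, rounded up. -/
def logSearch : Prog :=
  .loop (.op .lt (.reg 4) (.reg 0 * .reg 1)) <|
    .seq (.assign 4 (2 * .reg 4)) (.assign 3 (.reg 3 + 1))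

/-- Computes the parameters of the sketches, and the sketches. -/
def sketchPhase (C : ℕ) : Prog :=
  .seq (.assign 4 1) <|
  .seq logSearch <|
  .seq (.assign 5 (.lit C * .reg 2 * .reg 2 * .reg 3)) <|
  .seq (.assign 6 (.reg 0 * .reg 1 + .reg 0 + .reg 1)) <|
  .seq (.assign 7 (.reg 0)) <|
  .seq (.assign 8 1) <|
  .seq (.assign 9 (.reg 5 * .reg 0)) <|
  .seq (.assign 19 (.reg 6)) <|
  .seq (.assign 4 1) sketchAll

/-- Sets the parameters such that the only sketches are the points themselves. -/
def exactPhase : Prog :=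
  .seq (.assign 5 (.reg 1)) <|
  .seq (.assign 7 1) <|
  .seq (.assign 8 (.reg 1)) <|
  .assign 10 1

/-- The approximate nearest neighbour program. -/
def nnProg (C : ℕ) : Prog :=
  .seq paramSearch <|
  .seq (.ite (.leParam 1 (.reg 2)) (sketchPhase C) exactPhase) <|
  .seq (.assign 12 0) selectAll

/-- The result of `paramSearch`. -/
noncomputable def paramInv (δ : ℝ) (d : ℕ) : ℕ := min ⌈1 / δ⌉₊ (d + 1)

/-- The number of bits of a sketch. -/
noncomputable def sketchLength (C : ℕ) (δ : ℝ) (n d : ℕ) : ℕ :=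
  C * paramInv δ d * paramInv δ d * Nat.clog 2 (n * d)

section

variable {w : ℕ} {δ : ℝ} {ω : ℕ → Fin (2 ^ w)} {Q : State → Prop} {M X : ℕ → ℕ}
  {C dr n d k ℓ q m B s₁ s₂ s₃ L lo a j b c x y bs ptr h mid rr : ℕ}

theorem lt_paramInv_iff (hδ : 0 < δ) : k < paramInv δ d ↔ ¬ 1 ≤ δ * k ∧ ¬ d < k := by
  rw [paramInv, lt_min_iff, Nat.lt_ceil, lt_div_iff₀ hδ, not_le, mul_comm, Nat.lt_succ_iff, not_lt]

theorem runs_paramSearch (hδ : 0 < δ) (hd : d + 2 < 2 ^ w)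
    (hQ : Q (conf [n, d, paramInv δ d, ℓ, q, m, B, s₁, s₂, s₃, L, lo, a, j, b, c, x, y, bs, ptr,
      h, mid, rr] M dr)) :
    Runs w δ ω paramSearch
      (conf [n, d, 0, ℓ, q, m, B, s₁, s₂, s₃, L, lo, a, j, b, c, x, y, bs, ptr, h, mid, rr] M dr)
      (paramInv δ d * 14 + 10) Q := by
  have hle : paramInv δ d ≤ d + 1 := min_le_right _ _
  refine (Runs.for (I := fun k s => s = conf [n, d, k, ℓ, q, m, B, s₁, s₂, s₃, L, lo, a, j,
    b, c, x, y, bs, ptr, h, mid, rr] M dr) (T := 4) (paramInv δ d) ?_ ?_ ?_ ?_).mono ?_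
    fun _ h => h
  · rfl
  · rintro k s - rfl
    have h1 : 1 < 2 ^ w := by omega
    rw [lt_paramInv_iff hδ]
    by_cases hk : 1 ≤ δ * k <;> by_cases hk' : d < k
    -- If both tests succeed their sum is `2`, which must not wrap around to `0`.
    · have : (1 + 1) % 2 ^ w ≠ 0 := by
        by_cases h2 : 1 + 1 < 2 ^ w
        · rw [Nat.mod_eq_of_lt h2]; norm_num
        · omega
      simp [Nat.mod_eq_of_lt h1, hk, hk'] at this ⊢
      exact this
    all_goals simp [Nat.mod_eq_of_lt h1, hk, hk']
  · rintro k s hk rfl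
    have hk1 : k + 1 < 2 ^ w := by omega
    exact Runs.assign (v := k + 1) (by simp [Nat.mod_eq_of_lt hk1]) (by simp) (by simp)
  · rintro s rfl
    exact hQ
  · simp

theorem runs_logSearch (hnd : 2 * (n * d) < 2 ^ w)
    (hQ : ∀ q, Q (conf [n, d, k, Nat.clog 2 (n * d), q, m, B, s₁, s₂, s₃, L, lo, a, j, b, c, x, y,
      bs, ptr, h, mid, rr] M dr)) :
    Runs w δ ω logSearch
      (conf [n, d, k, 0, 1, m, B, s₁, s₂, s₃, L, lo, a, j, b, c, x, y, bs, ptr, h, mid, rr] M dr)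
      (Nat.clog 2 (n * d) * 14 + 6) Q := by
  have hpow : ∀ i, 2 ^ i < n * d ↔ i < Nat.clog 2 (n * d) :=
    fun i => (Nat.lt_clog_iff_pow_lt (by norm_num)).symm
  refine (Runs.for (I := fun ℓ s => s = conf [n, d, k, ℓ, 2 ^ ℓ, m, B, s₁, s₂, s₃, L, lo, a, j,
    b, c, x, y, bs, ptr, h, mid, rr] M dr) (T := 8) (Nat.clog 2 (n * d)) ?_ ?_ ?_ ?_).mono ?_
    fun _ h => h
  · simp
  · rintro i s - rfl
    have h1 : n * d < 2 ^ w := by omega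
    simp [Nat.mod_eq_of_lt h1, hpow]
  · rintro i s hi rfl
    have h1 := (hpow i).2 hi
    have h2i : 2 ^ i * 2 < 2 ^ w := by omega
    have h2 : 2 < 2 ^ w := by
      have := Nat.one_le_two_pow (n := i)
      omega
    have hi1 : i + 1 < 2 ^ w := by
      have : i < 2 ^ i := Nat.lt_two_pow_self
      omega
    exact (Runs.assign_seq (v := 2 ^ (i + 1))
      (by simp [pow_succ, mul_comm 2, Nat.mod_eq_of_lt h2, Nat.mod_eq_of_lt h2i]) (by simp) <|
      Runs.assign (v := i + 1) (by simp [Nat.mod_eq_of_lt hi1]) (by simp) (by simp)).mono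
      (by simp) fun _ h => h
  · rintro s rfl
    exact hQ _
  · simp

/-- Memory holds the input, the output, one block of `d` random bits, and then the sketches. Sketch
bit `j` of point `a` at scale `i` has offset `(i * m + j) * n + a`, so the strides are `m * n` for
`i`, `1` for `a` and `n` for `j`. -/
theorem runs_nnProg_sketch (hδ : 0 < δ) (hn : 2 ≤ n) (hd : 0 < d) (hC : 0 < C)
    (hk : 1 ≤ δ * paramInv δ d) (hnd : 2 * (n * d) < 2 ^ w) (hd' : 32 * d < 2 ^ w)
    (hm : 32 * (sketchLength C δ n d + 1) < 2 ^ w) (hL : 2 * Nat.clog 2 (16 * d) < 2 ^ w)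
    (hw : n * d + n + d + (Nat.clog 2 (16 * d) * sketchLength C δ n d + 1) * (n + 1) < 2 ^ w) :
    Runs w δ ω (nnProg C)
      (conf [n, d, 0, 0, 0, 0, 0, 0, 0, 0, 0, 0, 0, 0, 0, 0, 0, 0, 0, 0, 0, 0, 0] M 0)
      (d * 14 + Nat.clog 2 (n * d) * 14 + 100 +
        Nat.clog 2 (16 * d) *
          (sketchLength C δ n d * (d * 22 + n * (d * 28 + 23) + 20) + 20) +
        n * (Nat.clog 2 (Nat.clog 2 (16 * d)) * (n * (sketchLength C δ n d * 34 + 40) + 42) +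
          (n * (sketchLength C δ n d * 34 + 40) + 45)))
      fun s => ∀ a < n, IsSelected (fun i a j => sketchBit M ω d (2 ^ (i + 1))
          ((i * sketchLength C δ n d + j) * d) a)
        n (sketchLength C δ n d) (Nat.clog 2 (16 * d)) a (s.mem (n * d + a)) := by
  set m := sketchLength C δ n d with hmdef
  have hkle : paramInv δ d ≤ d + 1 := min_le_right _ _
  have hkpos : 0 < paramInv δ d := by
    rcases Nat.eq_zero_or_pos (paramInv δ d) with h | h
    · rw [h] at hk
      norm_num at hk
    · exact h
  have hmpos : 0 < m := by
    have : 0 < Nat.clog 2 (n * d) := Nat.clog_pos (by norm_num) (by nlinarith)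
    rw [hmdef, sketchLength]
    positivity
  have hLpos : 0 < Nat.clog 2 (16 * d) := Nat.clog_pos (by norm_num) (by omega)
  set N := Nat.clog 2 (16 * d) with hN
  have hNw : (N * m + 1) * (n + 1) = N * m * n + N * m + n + 1 := by ring
  have h1 : 1 < 2 ^ w := by omega
  have hmn : m * n < 2 ^ w := by
    have : m * n ≤ N * m * n := Nat.mul_le_mul_right n (Nat.le_mul_of_pos_left m hLpos)
    omega
  have hB : n * d + n + d < 2 ^ w := by omega
  refine (Runs.seq <| runs_paramSearch hδ (by omega) <|
    Runs.seq (T := Nat.clog 2 (n * d) * 14 + N * (m * (d * 22 + n * (d * 28 + 23) + 20) + 20) + 50)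
      (T' := n * (Nat.clog 2 N * (n * (m * 34 + 40) + 42) + (n * (m * 34 + 40) + 45)) + 10)
      ?_).mono (by omega) fun _ h => h
  refine (Runs.ite_true (by simpa [Nat.mod_eq_of_lt h1] using hk) <|
    Runs.assign_seq (v := 1) (by simp [Nat.mod_eq_of_lt h1]) (by simp) <|
    Runs.seq (T' := N * (m * (d * 22 + n * (d * 28 + 23) + 20) + 20) + 36) <|
    runs_logSearch hnd fun q => ?_).mono (by simp; omega) fun _ h => h
  refine (Runs.assign_seq (v := m)
      (by simp [← sketchLength.eq_1, ← hmdef, Nat.mod_eq_of_lt (show m < 2 ^ w by omega)])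
      (by simp) <|
    Runs.assign_seq (v := n * d + n + d) (by simp [Nat.mod_eq_of_lt hB]) (by simp) <|
    Runs.assign_seq (v := n) (by simp) (by simp) <|
    Runs.assign_seq (v := 1) (by simp [Nat.mod_eq_of_lt h1]) (by simp) <|
    Runs.assign_seq (v := m * n) (by simp [Nat.mod_eq_of_lt hmn]) (by simp) <|
    Runs.assign_seq (v := n * d + n + d) (by simp) (by simp) <|
    Runs.assign_seq (v := 1) (by simp [Nat.mod_eq_of_lt h1]) (by simp) <|
    runs_sketchAll (X := M) hd hw hd' (fun _ _ => rfl)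
      fun M' q a j b c ptr rr dr hS => ?_).mono (by simp [← hN]; omega) fun _ h => h
  refine (Runs.assign_seq (v := 0) (by simp) (by simp) <|
    runs_selectAll (V := fun i a j => sketchBit M ω d (2 ^ (i + 1)) ((i * m + j) * d) a)
    hn hm hmpos hLpos hL (by omega) ?_ fun s h => h).mono (by simp; omega) fun _ h => h
  intro i hi a ha j hj
  have e : n * d + n + d + i * (m * n) + a * 1 + j * n = n * d + n + d + (i * m + j) * n + a := by
    ring
  have hlt : i * m + j + 1 ≤ N * m :=
    calc i * m + j + 1 ≤ (i + 1) * m := by rw [add_mul, one_mul]; omega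
      _ ≤ N * m := Nat.mul_le_mul_right m hi
  have hle := Nat.mul_le_mul_right n hlt
  rw [add_mul, one_mul] at hle
  rw [e]
  exact ⟨by omega, by omega, hS.2 i j hj a ha hlt⟩

/-- With base `0`, row stride `d` and a single scale, the selection routine reads the points
themselves; the binary search stops at once and the nearest row is an exact nearest neighbour. -/
theorem runs_nnProg_exact (hδ : 0 < δ) (hn : 2 ≤ n) (hd : 0 < d)
    (hk : ¬ 1 ≤ δ * paramInv δ d) (hnd : n * d + n < 2 ^ w) (hd' : 32 * (d + 1) < 2 ^ w) :
    Runs w δ ω (nnProg C)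
      (conf [n, d, 0, 0, 0, 0, 0, 0, 0, 0, 0, 0, 0, 0, 0, 0, 0, 0, 0, 0, 0, 0, 0] M 0)
      (d * 14 + 100 + n * (n * (d * 34 + 40) + 45))
      fun s => ∀ a < n, IsSelected (fun _ a j => M (a * d + j)) n d 1 a (s.mem (n * d + a)) := by
  have hkle : paramInv δ d ≤ d + 1 := min_le_right _ _
  have h1 : 1 < 2 ^ w := by omega
  refine (Runs.seq (T' := 20 + (n * (n * (d * 34 + 40) + 45) + 10)) <| runs_paramSearch hδ (by omega) <|
    Runs.seq (T := 20) (T' := n * (n * (d * 34 + 40) + 45) + 10)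
      ?_).mono (by omega) fun _ h => h
  refine (Runs.ite_false (by simpa [Nat.mod_eq_of_lt h1] using hk) <|
    Runs.assign_seq (v := d) (by simp) (by simp) <|
    Runs.assign_seq (v := 1) (by simp [Nat.mod_eq_of_lt h1]) (by simp) <|
    Runs.assign_seq (v := d) (by simp) (by simp) <|
    Runs.assign (v := 1) (by simp [Nat.mod_eq_of_lt h1]) (by simp) ?_).mono (by simp) fun _ h => h
  refine (Runs.assign_seq (v := 0) (by simp) (by simp) <|
    runs_selectAll (V := fun _ a j => M (a * d + j))
    hn hd' hd one_pos (by omega) (by omega) ?_ fun s h => h).mono (by simp; omega) fun _ h => h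
  intro i _ a ha j hj
  have had : a * d + j < n * d := by
    calc a * d + j < (a + 1) * d := by rw [add_mul, one_mul]; omega
      _ ≤ n * d := Nat.mul_le_mul_right _ ha
  have e : 0 + i * 0 + a * d + j * 1 = a * d + j := by ring
  rw [e]
  exact ⟨by omega, by omega, rfl⟩

end

theorem inputState_eq_conf {n d : ℕ} (x : Fin n → Fin d → Bool) :
    inputState x = conf [n, d, 0, 0, 0, 0, 0, 0, 0, 0, 0, 0, 0, 0, 0, 0, 0, 0, 0, 0, 0, 0, 0]
      (inputState x).mem 0 := by
  have : (inputState x).regs = fun r => [n, d, 0, 0, 0, 0, 0, 0, 0, 0, 0, 0, 0, 0, 0, 0, 0, 0, 0, 0,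
      0, 0, 0].getD r 0 := by
    funext r
    by_cases hr : r < 23
    · interval_cases r <;> simp [inputState]
    · have h0 : r ≠ 0 := by omega
      have h1 : r ≠ 1 := by omega
      rw [List.getD_eq_default _ _ (by simpa using hr)]
      simp [inputState, h0, h1]
  rw [conf, ← this]
  rfl

theorem inputState_mem {n d : ℕ} (x : Fin n → Fin d → Bool) (i : Fin n) (j : Fin d) :
    (inputState x).mem (i * d + j) = if x i j then 1 else 0 := by
  have h1 : ((i : ℕ) * d + j) / d = i := by
    rw [mul_comm, Nat.mul_add_div (Nat.zero_lt_of_lt j.2), Nat.div_eq_of_lt j.2, add_zero]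
  have h2 : ((i : ℕ) * d + j) % d = j := by
    rw [mul_comm, Nat.mul_add_mod, Nat.mod_eq_of_lt j.2]
  simp [inputState, h1, h2]

/-! ### Sketch distances determine distances -/

/-- The probability that the sketch bits of two points at distance `h` differ at the scale `i`. -/
noncomputable def diffProb (i h : ℕ) : ℝ := (1 - (1 - (1 / 2) ^ i) ^ h) / 2

theorem half_pow_le_one (i : ℕ) : ((1 : ℝ) / 2) ^ i ≤ 1 :=
  pow_le_one₀ (by norm_num) (by norm_num)

theorem diffProb_mono (i : ℕ) {h h' : ℕ} (hh : h ≤ h') : diffProb i h ≤ diffProb i h' := by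
  have h1 := half_pow_le_one i
  have h2 : (0 : ℝ) < (1 / 2) ^ i := by positivity
  have := pow_le_pow_of_le_one (show (0 : ℝ) ≤ 1 - (1 / 2) ^ i by linarith) (by linarith) hh
  unfold diffProb
  linarith

/-- Bernoulli's inequality. It shows that the last scale samples too sparsely to be far. -/
theorem diffProb_le (i h : ℕ) : diffProb i h ≤ h * (1 / 2) ^ i / 2 := by
  have h1 := half_pow_le_one i
  have := one_add_mul_le_pow (show (-2 : ℝ) ≤ -(1 / 2) ^ i by linarith) h
  unfold diffProb
  rw [← sub_eq_add_neg] at this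
  linarith

/-- The minimum is attained at `h = 1`. It shows that scale `1` is always far when the estimates are
good, so scale `0` is never selected. -/
theorem diffProb_one {h : ℕ} (hh : 1 ≤ h) : 1 / 4 ≤ diffProb 1 h := by
  refine le_trans (by norm_num [diffProb]) (diffProb_mono 1 hh)

/-- Distances that differ by a factor of more than `1 + δ` have different sketch distances. -/
theorem diffProb_gap {δ : ℝ} (hδ : 0 < δ) (hδ1 : δ ≤ 1) {i h h' : ℕ} (hi : 1 ≤ i)
    (hup : diffProb (i + 1) h ≤ 1 / 8) (hlow : 1 / 16 ≤ diffProb i h)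
    (hh : (1 + δ) * h < h') : diffProb i h + δ * (27 / 1024) ≤ diffProb i h' := by
  obtain ⟨p, hp⟩ : ∃ p : ℝ, p = (1 / 2) ^ (i + 1) := ⟨_, rfl⟩
  have hp0 : 0 < p := by rw [hp]; positivity
  have hp4 : p ≤ 1 / 4 := by
    rw [hp]
    calc ((1 : ℝ) / 2) ^ (i + 1) ≤ (1 / 2) ^ 2 :=
          pow_le_pow_of_le_one (by norm_num) (by norm_num) (by omega)
      _ = 1 / 4 := by norm_num
  have hpi : ((1 : ℝ) / 2) ^ i = 2 * p := by rw [hp, pow_succ]; ring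
  unfold diffProb at *
  rw [← hp] at hup
  rw [hpi] at hlow ⊢
  have h1 : (3 : ℝ) / 4 ≤ (1 - p) ^ h := by linarith
  -- Scale `i` samples twice as densely as scale `i + 1`. For `p ≤ 1 / 4` this costs at most a third
  -- power, which keeps `(1 - 2 p) ^ h` away from `0`.
  have h2 : (1 - p) ^ 3 ≤ 1 - 2 * p := by nlinarith [mul_pos hp0 hp0]
  have h3 : (27 : ℝ) / 64 ≤ (1 - 2 * p) ^ h :=
    calc (27 : ℝ) / 64 = (3 / 4) ^ 3 := by norm_num
      _ ≤ ((1 - p) ^ h) ^ 3 := pow_le_pow_left₀ (by norm_num) h1 3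
      _ = ((1 - p) ^ 3) ^ h := by rw [← pow_mul, ← pow_mul, mul_comm]
      _ ≤ (1 - 2 * p) ^ h := pow_le_pow_left₀ (by have : 0 ≤ 1 - p := by linarith
                                                  positivity) h2 h
  have hq0 : 0 < 1 - 2 * p := by linarith
  obtain ⟨Q, hQ⟩ : ∃ Q : ℝ, Q = (1 - 2 * p) ^ h := ⟨_, rfl⟩
  rw [← hQ] at h3 hlow ⊢
  -- Bernoulli's inequality for the real exponent `δ ∈ [0, 1]` bounds `Q ^ δ` by its tangent at `Q =
  -- 1`.
  have h4 : (1 - 2 * p) ^ h' ≤ Q * (1 + δ * (Q - 1)) :=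
    calc (1 - 2 * p) ^ h' = (1 - 2 * p) ^ (h' : ℝ) := (Real.rpow_natCast _ _).symm
      _ ≤ (1 - 2 * p) ^ ((h : ℝ) + h * δ) :=
        Real.rpow_le_rpow_of_exponent_ge hq0 (by linarith) (by linarith)
      _ = Q * Q ^ δ := by
        rw [Real.rpow_add hq0, Real.rpow_mul hq0.le, Real.rpow_natCast, hQ]
      _ ≤ Q * (1 + δ * (Q - 1)) := by
        refine mul_le_mul_of_nonneg_left ?_ (by linarith)
        have := rpow_one_add_le_one_add_mul_self (show -1 ≤ Q - 1 by linarith) hδ.le hδ1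
        rwa [add_sub_cancel] at this
  -- The constant is `27 / 64 * (1 / 8)`, from `Q ≥ 27 / 64` and `Q ≤ 7 / 8`; the factor `1 / 2` in
  -- `diffProb` turns it into `27 / 1024`.
  have h6 : 27 / 512 ≤ Q * (1 - Q) := by
    nlinarith [mul_nonneg (sub_nonneg.2 h3) (show 0 ≤ 7 / 8 - Q by linarith)]
  have h5 := mul_le_mul_of_nonneg_left h6 hδ.le
  linarith

/-- If all sketch distances from the row `a` are close to their means, the selected row is an
approximately nearest one. -/
theorem IsSelected.le_mul {V : ℕ → ℕ → ℕ → ℕ} {n m L d a b : ℕ} {H : ℕ → ℕ} {δ : ℝ}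
    (hδ : 0 < δ) (hδ1 : δ < 1 / 2) (hm : 0 < m) (hL2 : 2 ≤ L) (hL : 16 * d ≤ 2 ^ L)
    (hH : ∀ b < n, b ≠ a → 1 ≤ H b ∧ H b ≤ d)
    (hgood : ∀ i < L, ∀ b < n, b ≠ a →
      |(diffCount (V i) m a b : ℝ) - m * diffProb i (H b)| ≤ δ / 100 * m)
    (hsel : IsSelected V n m L a b) :
    ∀ b' < n, b' ≠ a → (H b : ℝ) ≤ (1 + δ) * H b' := by
  obtain ⟨i, hi, ⟨hbn, hba, hmin⟩, hfar, hnear⟩ := hsel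
  intro b' hb' hba'
  have hm' : (0 : ℝ) < m := by exact_mod_cast hm
  have hδm : δ / 100 * m ≤ 1 / 200 * m := mul_le_mul_of_nonneg_right (by linarith) hm'.le
  -- The threshold `3 / 32` is the midpoint of `1 / 16` and `1 / 8`, and the error `1 / 200` is
  -- smaller than the distance `1 / 32` to either.
  have far_le : ∀ i < L, IsFar V n m i a → ∀ b < n, b ≠ a → 1 / 16 < diffProb i (H b) := by
    intro i hi hf b hb hb0
    have h1 := (abs_le.1 (hgood i hi b hb hb0)).2
    have h2 : (3 : ℝ) * m ≤ 32 * diffCount (V i) m a b := by exact_mod_cast hf b hb hb0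
    by_contra h3
    have h4 := mul_le_mul_of_nonneg_left (not_lt.1 h3) hm'.le
    linarith
  have near_le : ∀ i < L, ¬ IsFar V n m i a →
      ∃ b < n, b ≠ a ∧ diffProb i (H b) < 1 / 8 := by
    intro i hi hf
    unfold IsFar at hf
    push Not at hf
    obtain ⟨b, hb, hb0, h2⟩ := hf
    refine ⟨b, hb, hb0, ?_⟩
    have h1 := (abs_le.1 (hgood i hi b hb hb0)).1
    have h2 : (32 : ℝ) * diffCount (V i) m a b < 3 * m := by exact_mod_cast h2
    by_contra h3
    have h4 := mul_le_mul_of_nonneg_left (not_lt.1 h3) hm'.le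
    linarith
  have hi0 : i ≠ 0 := by
    rintro rfl
    rcases hnear with h | h
    · omega
    · obtain ⟨b, hb, hb0, h⟩ := near_le (0 + 1) (by omega) h
      have := diffProb_one (hH b hb hb0).1
      norm_num at h
      linarith
  have hfar : IsFar V n m i a := hfar.resolve_left hi0
  -- Being far at scale `L - 1` would require `diffProb > 1 / 16`, while `16 d ≤ 2 ^ L` bounds it by
  -- `d * 2 ^ -(L - 1) / 2 ≤ 1 / 16`.
  have hiL : i + 1 ≠ L := by
    intro h
    have h1 := far_le i hi hfar b hbn hba
    have h2 := diffProb_le i (H b)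
    have h3 : (H b : ℝ) ≤ d := by exact_mod_cast (hH b hbn hba).2
    have h4 : (16 : ℝ) * d ≤ 2 ^ L := by exact_mod_cast hL
    rw [← h, pow_succ] at h4
    have h5 : (H b : ℝ) * (1 / 2) ^ i ≤ 1 / 8 := by
      rw [one_div_pow, mul_one_div, div_le_iff₀ (by positivity)]
      linarith
    linarith
  have hnear : ¬ IsFar V n m (i + 1) a := hnear.resolve_left hiL
  by_contra hlt
  rw [not_le] at hlt
  obtain ⟨c, hc, hca, hcp⟩ := near_le (i + 1) (by omega) hnear
  -- The nearer of `b'` and `c` inherits the violated inequality from `b'` and the bound `1 / 8` at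
  -- scale `i + 1` from `c`; the gap estimate needs both.
  obtain ⟨e, he, hea, heb, hec⟩ : ∃ e < n, e ≠ a ∧ H e ≤ H b' ∧ H e ≤ H c := by
    rcases le_total (H b') (H c) with h | h
    · exact ⟨b', hb', hba', le_rfl, h⟩
    · exact ⟨c, hc, hca, h, le_rfl⟩
  have hlt : (1 + δ) * H e < H b := by
    refine lt_of_le_of_lt (mul_le_mul_of_nonneg_left ?_ (by linarith)) hlt
    exact_mod_cast heb
  have h1 := (diffProb_mono (i + 1) hec).trans hcp.le
  have h2 := diffProb_gap hδ (by linarith) (by omega) h1 (far_le i hi hfar e he hea).le hlt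
  have h3 := (abs_le.1 (hgood i hi b hbn hba)).1
  have h4 := (abs_le.1 (hgood i hi e he hea)).2
  have h5 : (diffCount (V i) m a b : ℝ) ≤ diffCount (V i) m a e := by
    exact_mod_cast hmin e he hea
  have h6 := mul_le_mul_of_nonneg_left h2 hm'.le
  -- Minimality of `b` in the sketch allows a gap of at most two errors, `2 δ / 100`, which is less
  -- than `27 δ / 1024`.
  nlinarith [mul_pos hδ hm']

/-! ### Concentration of the sketch distances -/

section Probability

open ProbabilityTheory

variable {w : ℕ}

instance : IsProbabilityMeasure (randomWords w) := by
  unfold randomWords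
  infer_instance

/-- The index map `(j, t) ↦ u + j * d + t` is injective, so the joint law of these words is a
product over pairs; currying makes it a product over `j` of block laws. -/
theorem iIndepFun_blocks (w u d : ℕ) :
    iIndepFun (fun (j : ℕ) (ω : ℕ → Fin (2 ^ w)) (t : Fin d) => ω (u + j * d + t))
      (randomWords w) := by
  have hinj : Function.Injective fun p : ℕ × Fin d => u + p.1 * d + (p.2 : ℕ) := by
    rintro ⟨j, t⟩ ⟨j', t'⟩ h
    have h' : j * d + t = j' * d + t' := by simpa [add_assoc] using h
    have hd : 0 < d := Nat.zero_lt_of_lt t.2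
    have h1 := congrArg (· / d) h'
    have h2 := congrArg (· % d) h'
    simp only [mul_comm _ d, Nat.mul_add_div hd, Nat.div_eq_of_lt t.2, Nat.div_eq_of_lt t'.2,
      Nat.mul_add_mod, Nat.mod_eq_of_lt t.2, Nat.mod_eq_of_lt t'.2, add_zero] at h1 h2
    exact Prod.ext h1 (Fin.ext h2)
  obtain ⟨ν, hν⟩ : ∃ ν : Measure (Fin (2 ^ w)), ν = (PMF.uniformOfFintype _).toMeasure := ⟨_, rfl⟩
  have : IsProbabilityMeasure ν := by rw [hν]; infer_instance
  have hmap : (randomWords w).map (fun ω (j : ℕ) (t : Fin d) => ω (u + j * d + t)) =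
      Measure.infinitePi fun _ : ℕ => Measure.infinitePi fun _ : Fin d => ν := by
    have h1 := Measure.map_infinitePi_infinitePi_of_inj
      (P := fun _ : ℕ => ν) hinj
    have h2 := Measure.infinitePi_map_curry (fun (_ : ℕ) (_ : Fin d) => ν)
    rw [← h2, ← h1, Measure.map_map (by fun_prop) (by fun_prop), randomWords, hν]
    rfl
  have hmeas : Measurable fun (ω : ℕ → Fin (2 ^ w)) (j : ℕ) (t : Fin d) => ω (u + j * d + t) := by
    fun_prop
  rw [iIndepFun_iff_map_fun_eq_infinitePi_map (by fun_prop), hmap]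
  congr 1
  funext j
  rw [← Measure.infinitePi_map_eval (fun _ : ℕ => Measure.infinitePi fun _ : Fin d => ν) j, ← hmap,
    Measure.map_map (by fun_prop) hmeas]
  rfl

/-- The sign of a word: `-1` if it is divisible by `g`, and `1` otherwise. -/
def wordSign (g y : ℕ) : ℝ := if y % g = 0 then -1 else 1

/-- Each period of length `g` contains one multiple of `g` and contributes `(g - 1) - 1`. -/
theorem sum_wordSign (g k : ℕ) (hg : 0 < g) :
    ∑ y ∈ Finset.range (g * k), wordSign g y = k * (g - 2) := by
  induction k with
  | zero => simp
  | succ k ih =>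
    obtain ⟨g, rfl⟩ : ∃ g', g = g' + 1 := ⟨g - 1, by omega⟩
    have : ∑ y ∈ Finset.range (g + 1), wordSign (g + 1) ((g + 1) * k + y) = (g + 1 : ℕ) - 2 := by
      rw [Finset.sum_range_succ']
      have : ∀ y ∈ Finset.range g, wordSign (g + 1) ((g + 1) * k + (y + 1)) = 1 := by
        intro y hy
        rw [Finset.mem_range] at hy
        have : (y + 1) % (g + 1) = y + 1 := Nat.mod_eq_of_lt (by omega)
        simp [wordSign, this]
      rw [Finset.sum_congr rfl this]
      simp [wordSign]
      ring
    rw [mul_add, mul_one, Finset.sum_range_add, ih, this]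
    push_cast
    ring

/-- Since `i + 1 ≤ w`, the number `2 ^ w` of words is a multiple of `2 ^ (i + 1)`. The sampling
probability is then exactly `2 ^ -(i + 1)`, with no rounding error. -/
theorem integral_wordSign {i : ℕ} (hi : i + 1 ≤ w) (u : ℕ) :
    ∫ ω, wordSign (2 ^ (i + 1)) (ω u : ℕ) ∂randomWords w = 1 - (1 / 2) ^ i := by
  have h := (measurePreserving_eval_infinitePi
    (fun _ : ℕ => (PMF.uniformOfFintype (Fin (2 ^ w))).toMeasure) u).map_eq
  have h1 : ∫ ω, wordSign (2 ^ (i + 1)) (ω u : ℕ) ∂randomWords w =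
      ∫ y, wordSign (2 ^ (i + 1)) (y : ℕ) ∂(PMF.uniformOfFintype (Fin (2 ^ w))).toMeasure := by
    rw [← h, integral_map (measurable_pi_apply u).aemeasurable
      (Measurable.of_discrete.aestronglyMeasurable)]
    rfl
  rw [h1, PMF.integral_eq_sum]
  obtain ⟨r, rfl⟩ := Nat.exists_eq_add_of_le hi
  have h2 := sum_wordSign (2 ^ (i + 1)) (2 ^ r) (by positivity)
  rw [← pow_add, ← Fin.sum_univ_eq_sum_range] at h2
  simp only [PMF.uniformOfFintype_apply, smul_eq_mul, ← Finset.mul_sum, h2]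
  simp [pow_add]
  field_simp

/-- The sign of the parity of the random bits in a block on the coordinates where `p` and `q`
differ. -/
noncomputable def blockSign {d : ℕ} (p q : Fin d → Bool) (g : ℕ) (y : Fin d → Fin (2 ^ w)) : ℝ :=
  ∏ t, if p t = q t then 1 else wordSign g (y t)

/-- By independence the expectation factors over the coordinates; only those where `p` and `q`
differ contribute a factor other than `1`. -/
theorem integral_blockSign {d : ℕ} (p q : Fin d → Bool) {i : ℕ} (hi : i + 1 ≤ w) (u : ℕ) :
    ∫ ω, blockSign p q (2 ^ (i + 1)) (fun t => ω (u + t)) ∂randomWords w =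
      (1 - (1 / 2) ^ i) ^ hammingDist p q := by
  unfold blockSign
  have hind : iIndepFun (fun (k : ℕ) (ω : ℕ → Fin (2 ^ w)) => ω k) (randomWords w) :=
    iIndepFun_infinitePi (P := fun _ : ℕ => (PMF.uniformOfFintype (Fin (2 ^ w))).toMeasure)
      (X := fun _ y => y) (fun _ => measurable_id)
  have hinj : Function.Injective fun t : Fin d => u + (t : ℕ) := fun t t' h => by
    simpa [Fin.ext_iff] using h
  have hind' := (hind.precomp hinj).comp
    (fun t y => if p t = q t then (1 : ℝ) else wordSign (2 ^ (i + 1)) (y : ℕ))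
    (fun _ => Measurable.of_discrete)
  have := hind'.integral_fun_prod_eq_prod_integral (fun t =>
    (Measurable.of_discrete.comp (measurable_pi_apply _)).aestronglyMeasurable)
  refine this.trans ?_
  have hval : ∀ t, ∫ ω, ((fun y : Fin (2 ^ w) => if p t = q t then (1 : ℝ) else
      wordSign (2 ^ (i + 1)) (y : ℕ)) ∘ fun ω : ℕ → Fin (2 ^ w) => ω (u + t)) ω ∂randomWords w =
      if p t = q t then 1 else 1 - (1 / 2) ^ i := by
    intro t
    by_cases h : p t = q t
    · simp [h]
    · simp only [h, Function.comp_apply, if_false]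
      exact integral_wordSign hi _
  refine (Finset.prod_congr rfl fun t _ => hval t).trans ?_
  rw [Finset.prod_ite]
  simp [hammingDist]

theorem abs_blockSign {d : ℕ} (p q : Fin d → Bool) (g : ℕ) (y : Fin d → Fin (2 ^ w)) :
    |blockSign p q g y| = 1 := by
  rw [blockSign, Finset.abs_prod]
  refine Finset.prod_eq_one fun t _ => ?_
  unfold wordSign
  split_ifs <;> simp

/-- Hoeffding's inequality, applied to the sum and to its negative. Signs lie in `[-1, 1]`, so each
centred term has sub-Gaussian parameter `1`. -/
theorem measure_abs_sum_blockSign {d : ℕ} (p q : Fin d → Bool) {i : ℕ} (hi : i + 1 ≤ w)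
    (u m : ℕ) {ε : ℝ} (hε : 0 ≤ ε) :
    (randomWords w).real {ω | ε < |∑ j ∈ Finset.range m,
      (blockSign p q (2 ^ (i + 1)) (fun t => ω (u + j * d + t)) -
        (1 - (1 / 2) ^ i) ^ hammingDist p q)|} ≤ 2 * Real.exp (-ε ^ 2 / (2 * m)) := by
  have hind := (iIndepFun_blocks w u d).comp
    (fun _ y => blockSign p q (2 ^ (i + 1)) y - (1 - (1 / 2) ^ i) ^ hammingDist p q)
    (fun _ => Measurable.of_discrete)
  have hsub : ∀ j, HasSubgaussianMGF (fun ω : ℕ → Fin (2 ^ w) =>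
      blockSign p q (2 ^ (i + 1)) (fun t => ω (u + j * d + t)) -
        (1 - (1 / 2) ^ i) ^ hammingDist p q) 1 (randomWords w) := by
    intro j
    have hm : Measurable fun ω : ℕ → Fin (2 ^ w) =>
        blockSign p q (2 ^ (i + 1)) (fun t => ω (u + j * d + t)) :=
      (Measurable.of_discrete (f := blockSign p q (2 ^ (i + 1)))).comp (by fun_prop)
    have h := hasSubgaussianMGF_of_mem_Icc (a := -1) (b := 1) (μ := randomWords w) hm.aemeasurable
      (ae_of_all _ fun ω => abs_le.1 (abs_blockSign p q _ _).le)
    rw [integral_blockSign p q hi] at h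
    convert h using 1
    norm_num
  have h1 := HasSubgaussianMGF.measure_sum_range_ge_le_of_iIndepFun hind (n := m)
    (fun j _ => hsub j) hε
  have hind2 := hind.comp (fun _ y => -y) (fun _ => measurable_neg)
  have h2 := HasSubgaussianMGF.measure_sum_range_ge_le_of_iIndepFun hind2 (n := m)
    (fun j _ => (hsub j).neg) hε
  simp only [NNReal.coe_one, mul_one] at h1 h2
  refine (measureReal_mono (s₂ := _ ∪ _) ?_ (measure_ne_top _ _)).trans ((measureReal_union_le _ _).trans
    ((add_le_add h1 h2).trans_eq (two_mul _).symm))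
  intro ω hω
  rw [Set.mem_ofPred_eq, lt_abs] at hω
  rcases hω with h | h
  · exact .inl h.le
  · refine .inr ?_
    rw [← Finset.sum_neg_distrib] at h
    exact h.le

end Probability

section Concentration

variable {w : ℕ}

theorem ite_mod_two_eq (r s : ℕ) :
    (if r % 2 = s % 2 then (0 : ℝ) else 1) = (1 - (-1) ^ (r + s)) / 2 := by
  rcases Nat.even_or_odd (r + s) with h | h
  · have : r % 2 = s % 2 := by
      have := Nat.even_iff.1 h
      omega
    simp [this, h.neg_one_pow]
  · have : r % 2 ≠ s % 2 := by
      have := Nat.odd_iff.1 h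
      omega
    simp [this, h.neg_one_pow]

/-- Coordinates where the points agree contribute an even amount to the sum of the two parities, so
the parity of the sum depends only on the random bits where they differ. -/
theorem ite_sketchBit_eq {n d : ℕ} (x : Fin n → Fin d → Bool) (ω : ℕ → Fin (2 ^ w)) (g u : ℕ)
    (a b : Fin n) :
    (if sketchBit (inputState x).mem ω d g u a = sketchBit (inputState x).mem ω d g u b
      then (0 : ℝ) else 1) = (1 - blockSign (x a) (x b) g fun t => ω (u + t)) / 2 := by
  unfold sketchBit
  rw [ite_mod_two_eq, ← Fin.sum_univ_eq_sum_range
      (fun t => (inputState x).mem (a * d + t) * randBit ω g (u + t)),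
    ← Fin.sum_univ_eq_sum_range
      (fun t => (inputState x).mem (b * d + t) * randBit ω g (u + t)),
    ← Finset.sum_add_distrib, ← Finset.prod_pow_eq_pow_sum]
  congr 2
  refine Finset.prod_congr rfl fun t _ => ?_
  rw [inputState_mem, inputState_mem, randBit, wordSign]
  by_cases h : (ω (u + t) : ℕ) % g = 0 <;> cases x a t <;> cases x b t <;> simp [h]

/-- The sketch bits computed by the program. -/
def sketch {n d : ℕ} (x : Fin n → Fin d → Bool) (m : ℕ) (ω : ℕ → Fin (2 ^ w)) (i a j : ℕ) : ℕ :=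
  sketchBit (inputState x).mem ω d (2 ^ (i + 1)) ((i * m + j) * d) a

theorem diffCount_sketch {n d : ℕ} (x : Fin n → Fin d → Bool) (m : ℕ) (ω : ℕ → Fin (2 ^ w))
    (i : ℕ) (a b : Fin n) :
    (diffCount (sketch x m ω i) m a b : ℝ) - m * diffProb i (hammingDist (x a) (x b)) =
      -(∑ j ∈ Finset.range m,
        (blockSign (x a) (x b) (2 ^ (i + 1)) (fun t => ω (i * m * d + j * d + t)) -
          (1 - (1 / 2) ^ i) ^ hammingDist (x a) (x b))) / 2 := by
  have h : (diffCount (sketch x m ω i) m a b : ℝ) = ∑ j ∈ Finset.range m,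
      (1 - blockSign (x a) (x b) (2 ^ (i + 1)) (fun t => ω (i * m * d + j * d + t))) / 2 := by
    rw [diffCount]
    push_cast
    refine Finset.sum_congr rfl fun j _ => ?_
    rw [← add_mul, ← ite_sketchBit_eq]
    rfl
  rw [h, ← Finset.sum_div, Finset.sum_sub_distrib, Finset.sum_sub_distrib, diffProb]
  simp
  ring

/-- With high probability, all sketch distances are close to their means. -/
theorem measure_sketch_close {n d : ℕ} (x : Fin n → Fin d → Bool) {m L : ℕ} (hL : L ≤ w) {δ : ℝ}
    (hδ : 0 ≤ δ) :
    1 - L * n ^ 2 * (2 * Real.exp (-(δ ^ 2 * m / 5000))) ≤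
      (randomWords w).real {ω | ∀ i < L, ∀ a b : Fin n,
        |(diffCount (sketch x m ω i) m a b : ℝ) - m * diffProb i (hammingDist (x a) (x b))|
          ≤ δ / 100 * m} := by
  set good := {ω : ℕ → Fin (2 ^ w) | ∀ i < L, ∀ a b : Fin n,
    |(diffCount (sketch x m ω i) m a b : ℝ) - m * diffProb i (hammingDist (x a) (x b))|
      ≤ δ / 100 * m}
  -- The threshold is `δ / 50` rather than `δ / 100` because a difference indicator is `(1 - sign) /
  -- 2`.
  set bad : ℕ × Fin n × Fin n → Set (ℕ → Fin (2 ^ w)) := fun p => {ω | δ / 50 * m <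
    |∑ j ∈ Finset.range m,
      (blockSign (x p.2.1) (x p.2.2) (2 ^ (p.1 + 1)) (fun t => ω (p.1 * m * d + j * d + t)) -
        (1 - (1 / 2) ^ p.1) ^ hammingDist (x p.2.1) (x p.2.2))|}
  set I : Finset (ℕ × Fin n × Fin n) := Finset.range L ×ˢ Finset.univ
  -- Covering the whole space and using subadditivity avoids having to show that `good` is
  -- measurable.
  have hcover : (Set.univ : Set (ℕ → Fin (2 ^ w))) ⊆ good ∪ ⋃ p ∈ I, bad p := by
    intro ω _
    by_cases hω : ω ∈ good
    · exact .inl hω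
    · refine .inr ?_
      simp only [good, Set.mem_ofPred_eq] at hω
      push Not at hω
      obtain ⟨i, hi, a, b, h⟩ := hω
      refine Set.mem_biUnion (x := (i, a, b)) (by simp [I, hi]) ?_
      rw [diffCount_sketch, abs_div, abs_neg, abs_two] at h
      simp only [bad, Set.mem_ofPred_eq]
      linarith
  have hbad : ∀ p ∈ I, (randomWords w).real (bad p) ≤ 2 * Real.exp (-(δ ^ 2 * m / 5000)) := by
    rintro ⟨i, a, b⟩ hp
    have hi : i < L := by simpa [I] using hp
    refine (measure_abs_sum_blockSign (x a) (x b) (show i + 1 ≤ w by omega) (i * m * d) m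
      (show 0 ≤ δ / 50 * m by positivity)).trans (le_of_eq ?_)
    congr 2
    rcases Nat.eq_zero_or_pos m with rfl | hm
    · simp
    · have : (m : ℝ) ≠ 0 := by positivity
      field_simp
      ring
  have h1 : (1 : ℝ) ≤ (randomWords w).real good + (randomWords w).real (⋃ p ∈ I, bad p) :=
    calc (1 : ℝ) = (randomWords w).real Set.univ := by simp
      _ ≤ _ := (measureReal_mono hcover (measure_ne_top _ _)).trans (measureReal_union_le _ _)
  have h2 : (randomWords w).real (⋃ p ∈ I, bad p) ≤
      L * n ^ 2 * (2 * Real.exp (-(δ ^ 2 * m / 5000))) := by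
    refine (measureReal_biUnion_finset_le _ _).trans ((Finset.sum_le_card_nsmul _ _ _ hbad).trans ?_)
    rw [nsmul_eq_mul]
    refine le_of_eq ?_
    congr 1
    simp [I, sq]
  linarith

end Concentration

/-! ### Failure probability against sketch length. -/

theorem log_le_clog {N : ℕ} (hN : 0 < N) : Real.log N ≤ Nat.clog 2 N := by
  have h1 : (N : ℝ) ≤ 2 ^ Nat.clog 2 N := by exact_mod_cast Nat.le_pow_clog (by norm_num) N
  have h2 := Real.log_le_log (by positivity) h1
  rw [Real.log_pow] at h2
  have h3 : Real.log 2 ≤ 1 := by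
    have := Real.log_two_lt_d9
    linarith
  nlinarith [Nat.cast_nonneg (α := ℝ) (Nat.clog 2 N)]

theorem clog_le_self (N : ℕ) : Nat.clog 2 N ≤ N :=
  (Nat.clog_le_iff_le_pow (by norm_num)).2 Nat.lt_two_pow_self.le

/-- The failure probability of the sketches. -/
theorem failure_le {α δ : ℝ} {n d C : ℕ} (hn : 2 ≤ n) (hd : 2 ≤ d)
    (hC : 5000 * (α + 6) ≤ C) (hk : 1 ≤ δ * paramInv δ d) :
    (Nat.clog 2 (16 * d) : ℝ) * n ^ 2 *
      (2 * Real.exp (-(δ ^ 2 * sketchLength C δ n d / 5000))) ≤ 1 / ((n : ℝ) * d) ^ α := by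
  obtain ⟨N, hN⟩ : ∃ N : ℝ, N = n * d := ⟨_, rfl⟩
  have hn' : (2 : ℝ) ≤ n := by exact_mod_cast hn
  have hd' : (2 : ℝ) ≤ d := by exact_mod_cast hd
  have hN4 : 4 ≤ N := by rw [hN]; nlinarith
  have hL : (Nat.clog 2 (16 * d) : ℝ) ≤ 16 * d := by exact_mod_cast clog_le_self (16 * d)
  -- The union bound costs at most `N ^ 6`, which is what the `6` in `C ≥ 5000 (α + 6)` pays for.
  have h1 : (Nat.clog 2 (16 * d) : ℝ) * n ^ 2 * 2 ≤ N ^ 6 :=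
    calc (Nat.clog 2 (16 * d) : ℝ) * n ^ 2 * 2 ≤ 16 * (d : ℝ) * n ^ 2 * 2 := by gcongr
      _ ≤ 4 ^ 4 * ((d : ℝ) ^ 2 * n ^ 2) := by
        have h1 : (d : ℝ) ≤ d ^ 2 := by nlinarith
        have h2 := mul_le_mul_of_nonneg_right h1 (sq_nonneg (n : ℝ))
        nlinarith [mul_nonneg (sq_nonneg (d : ℝ)) (sq_nonneg (n : ℝ))]
      _ = 4 ^ 4 * N ^ 2 := by rw [hN]; ring
      _ ≤ N ^ 4 * N ^ 2 := by gcongr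
      _ = N ^ 6 := by ring
  have hlog : Real.log N ≤ Nat.clog 2 (n * d) := by
    have := log_le_clog (N := n * d) (by positivity)
    rwa [Nat.cast_mul, ← hN] at this
  have hlog0 : 0 ≤ Real.log N := Real.log_nonneg (by linarith)
  have h2 : (α + 6) * Real.log N ≤ δ ^ 2 * sketchLength C δ n d / 5000 := by
    have hk2 : 1 ≤ (δ * paramInv δ d) * (δ * paramInv δ d) := one_le_mul_of_one_le_of_one_le hk hk
    have hCl : 5000 * (α + 6) * Real.log N ≤ C * Nat.clog 2 (n * d) := by gcongr
    have : δ ^ 2 * (sketchLength C δ n d : ℝ) =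
        (C * Nat.clog 2 (n * d)) * ((δ * paramInv δ d) * (δ * paramInv δ d)) := by
      rw [sketchLength]
      push_cast
      ring
    rw [this]
    have h0 : (0 : ℝ) ≤ C * Nat.clog 2 (n * d) := by positivity
    have := mul_le_mul_of_nonneg_left hk2 h0
    linarith
  calc (Nat.clog 2 (16 * d) : ℝ) * n ^ 2 *
      (2 * Real.exp (-(δ ^ 2 * sketchLength C δ n d / 5000)))
      = (Nat.clog 2 (16 * d) : ℝ) * n ^ 2 * 2 *
        Real.exp (-(δ ^ 2 * sketchLength C δ n d / 5000)) := by ring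
    _ ≤ N ^ 6 * Real.exp (-((α + 6) * Real.log N)) := by gcongr
    _ = 1 / N ^ α := by
      have hpos : 0 < N := by linarith
      have : Real.exp (-((α + 6) * Real.log N)) = N ^ (-(α + 6)) := by
        rw [Real.rpow_def_of_pos hpos]; ring_nf
      rw [this, ← Real.rpow_natCast, ← Real.rpow_add hpos, one_div, ← Real.rpow_neg hpos.le]
      congr 1
      push_cast
      ring
    _ = 1 / ((n : ℝ) * d) ^ α := by rw [hN]

/-! ### Word length and running time -/

theorem clog_le_log {N : ℕ} (hN : 2 ≤ N) : (Nat.clog 2 N : ℝ) ≤ 3 / 2 * Real.log N + 1 := by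
  have h1 : (2 : ℝ) ^ (Nat.clog 2 N - 1) < N := by
    exact_mod_cast Nat.pow_pred_clog_lt_self (by norm_num) hN
  have h2 := Real.log_lt_log (by positivity) h1
  have h3 : 0 < Nat.clog 2 N := Nat.clog_pos (by norm_num) hN
  rw [Real.log_pow, Nat.cast_sub h3, Nat.cast_one] at h2
  have h4 := Real.log_two_gt_d9
  have h5 : (1 : ℝ) ≤ Nat.clog 2 N := by exact_mod_cast h3
  nlinarith

theorem paramInv_le {δ : ℝ} (hδ : 0 < δ) (hδ2 : δ < 1 / 2) (d : ℕ) :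
    δ * paramInv δ d ≤ 3 / 2 := by
  have h1 : (paramInv δ d : ℝ) ≤ ⌈1 / δ⌉₊ := by exact_mod_cast min_le_left _ _
  have h2 := Nat.ceil_lt_add_one (show 0 ≤ 1 / δ by positivity)
  have h3 := mul_le_mul_of_nonneg_left (h1.trans h2.le) hδ.le
  have h4 : δ * (1 / δ + 1) = 1 + δ := by field_simp
  linarith

/-- If `paramInv` were `⌈1 / δ⌉` the test would succeed, so failure means that the truncation at `d
+ 1` was active. -/
theorem lt_one_of_paramInv {δ : ℝ} (hδ : 0 < δ) {d : ℕ} (hk : ¬ 1 ≤ δ * paramInv δ d) :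
    δ * (d + 1) < 1 := by
  rcases min_choice ⌈1 / δ⌉₊ (d + 1) with h | h
  · refine absurd ?_ hk
    rw [paramInv, h]
    have := mul_le_mul_of_nonneg_left (Nat.le_ceil (1 / δ)) hδ.le
    rwa [mul_one_div_cancel hδ.ne'] at this
  · rw [paramInv, h] at hk
    push_cast at hk
    exact not_le.1 hk

section Sizes

variable {n d C w : ℕ} {δ : ℝ}

/-- The truncation of `paramInv` at `d + 1` gives a bound polynomial in `n * d` and independent of
`δ`, as the word length requires. -/
theorem sketchLength_le (hn : 2 ≤ n) (hd : 2 ≤ d) :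
    sketchLength C δ n d ≤ (n * d) ^ (C + 3) := by
  have hN : 2 ≤ n * d := by nlinarith
  have hk : paramInv δ d ≤ n * d := (min_le_right _ _).trans (by nlinarith)
  have hC : C ≤ (n * d) ^ C := Nat.lt_two_pow_self.le.trans (Nat.pow_le_pow_left hN C)
  calc sketchLength C δ n d ≤ (n * d) ^ C * (n * d) * (n * d) * (n * d) := by
        unfold sketchLength
        gcongr
        exact clog_le_self _
    _ = (n * d) ^ (C + 3) := by ring

theorem sketchLength_pos (hn : 2 ≤ n) (hd : 2 ≤ d) (hC : 0 < C) (hk : 1 ≤ δ * paramInv δ d) :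
    0 < sketchLength C δ n d := by
  have hkpos : 0 < paramInv δ d := by
    rcases Nat.eq_zero_or_pos (paramInv δ d) with h | h
    · rw [h] at hk
      norm_num at hk
    · exact h
  have : 0 < Nat.clog 2 (n * d) := Nat.clog_pos (by norm_num) (by nlinarith)
  rw [sketchLength]
  positivity

theorem word_bounds (hn : 2 ≤ n) (hd : 2 ≤ d) (hw : (n * d) ^ (C + 9) ≤ 2 ^ w) :
    2 * (n * d) < 2 ^ w ∧ 32 * (d + 1) < 2 ^ w ∧ 32 * (sketchLength C δ n d + 1) < 2 ^ w ∧
      2 * Nat.clog 2 (16 * d) < 2 ^ w ∧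
      n * d + n + d + (Nat.clog 2 (16 * d) * sketchLength C δ n d + 1) * (n + 1) < 2 ^ w := by
  have hm := sketchLength_le (C := C) (δ := δ) hn hd
  have hL := clog_le_self (16 * d)
  obtain ⟨m, hm'⟩ : ∃ m, m = sketchLength C δ n d := ⟨_, rfl⟩
  obtain ⟨L, hL'⟩ : ∃ L, L = Nat.clog 2 (16 * d) := ⟨_, rfl⟩
  rw [← hm'] at hm ⊢
  rw [← hL'] at hL ⊢
  obtain ⟨N, hN⟩ : ∃ N, N = n * d := ⟨_, rfl⟩
  have hN4 : 4 ≤ N := by nlinarith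
  have hnN : n ≤ N := by nlinarith
  have hdN : d ≤ N := by nlinarith
  rw [← hN] at hm hw ⊢
  obtain ⟨P, hP⟩ : ∃ P, P = N ^ (C + 3) := ⟨_, rfl⟩
  rw [← hP] at hm
  have hP1 : 1 ≤ P := by rw [hP]; exact Nat.one_le_pow _ _ (by omega)
  -- The exponent splits as `C + 9 = 4 + 2 + (C + 3)`; the fourth power, at least `256`, absorbs all
  -- numerical constants below.
  have hbig : 256 * (N ^ 2 * P) ≤ 2 ^ w := by
    refine le_trans ?_ hw
    calc 256 * (N ^ 2 * P) = 4 ^ 4 * (N ^ 2 * P) := by norm_num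
      _ ≤ N ^ 4 * (N ^ 2 * P) := by gcongr
      _ = N ^ (C + 9) := by rw [hP]; ring
  have hNP : N ≤ N ^ 2 * P := by nlinarith
  have hPP : P ≤ N ^ 2 * P := Nat.le_mul_of_pos_left _ (by positivity)
  have hNP1 : 16 ≤ N ^ 2 * P := by nlinarith
  refine ⟨by omega, by omega, by omega, by omega, ?_⟩
  have h1 : (L * m + 1) * (n + 1) ≤ 34 * (N ^ 2 * P) :=
    calc (L * m + 1) * (n + 1) ≤ (16 * N * P + N * P) * (N + N) := by
          gcongr
          · omega
          · nlinarith
          · omega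
      _ = 34 * (N ^ 2 * P) := by ring
  omega

end Sizes

/-- The factors of the time bound. -/
theorem timeBound_facts {δ : ℝ} {n d : ℕ} (hδ : 0 < δ) (hδ2 : δ < 1 / 2) (hn : 2 ≤ n)
    (hd : 2 ≤ d) :
    1 ≤ Real.log ((n : ℝ) * d) ∧ 2 * Real.log d ≤ Real.logb (1 + δ) d ∧
      1 ≤ Real.logb (1 + δ) d ∧ 1 / 4 ≤ Real.log (Real.logb (1 + δ) d) := by
  have hn' : (2 : ℝ) ≤ n := by exact_mod_cast hn
  have hd' : (2 : ℝ) ≤ d := by exact_mod_cast hd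
  have h2 := Real.log_two_gt_d9
  have h3 : Real.log 2 ≤ Real.log n := Real.log_le_log (by norm_num) hn'
  have h4 : Real.log 2 ≤ Real.log d := Real.log_le_log (by norm_num) hd'
  have h5 : 0 < Real.log (1 + δ) := Real.log_pos (by linarith)
  have h6 : Real.log (1 + δ) ≤ δ := by
    have := Real.log_le_sub_one_of_pos (show 0 < 1 + δ by linarith)
    linarith
  have h7 : 2 * Real.log d ≤ Real.logb (1 + δ) d := by
    rw [Real.logb, le_div_iff₀ h5]
    nlinarith
  -- From `2 * log 2 > 1.38`. The factor `2` comes from `δ < 1 / 2` and keeps the iterated logarithm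
  -- bounded away from `0`, so that it can absorb constants.
  have h8 : 1.38 ≤ Real.logb (1 + δ) d := by linarith
  refine ⟨?_, h7, by linarith, ?_⟩
  · rw [Real.log_mul (by positivity) (by positivity)]
    linarith
  · have := Real.one_sub_inv_le_log_of_pos (show 0 < Real.logb (1 + δ) d by linarith)
    have h9 : (Real.logb (1 + δ) d)⁻¹ ≤ 1.38⁻¹ := inv_anti₀ (by norm_num) h8
    norm_num at h9
    linarith

theorem nnTimeBound_nonneg {δ : ℝ} {n d : ℕ} (hδ : 0 < δ) (hδ2 : δ < 1 / 2) (hn : 2 ≤ n)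
    (hd : 2 ≤ d) : 0 ≤ nnTimeBound δ n d := by
  obtain ⟨hl, -, hY, hlog⟩ := timeBound_facts hδ hδ2 hn hd
  unfold nnTimeBound
  positivity

/-- Here `δ (d + 1) < 1`, hence `d ≤ 1 / δ²`, and the `n² d` steps of the exact comparison are paid
for by the second summand of the bound. -/
theorem exact_time_le {δ : ℝ} {n d : ℕ} (hδ : 0 < δ) (hδ2 : δ < 1 / 2) (hn : 2 ≤ n) (hd : 2 ≤ d)
    (hk : ¬ 1 ≤ δ * paramInv δ d) :
    ((d * 14 + 100 + n * (n * (d * 34 + 40) + 45) : ℕ) : ℝ) ≤ 1000 * nnTimeBound δ n d := by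
  obtain ⟨hl, -, hY, hlog⟩ := timeBound_facts hδ hδ2 hn hd
  have hn' : (2 : ℝ) ≤ n := by exact_mod_cast hn
  have hd' : (2 : ℝ) ≤ d := by exact_mod_cast hd
  have hk' := lt_one_of_paramInv hδ hk
  have h1 : (d : ℝ) ≤ 1 / δ ^ 2 := by
    rw [le_div_iff₀ (by positivity)]
    nlinarith
  have h2 : d * 14 + 100 + n * (n * (d * 34 + 40) + 45) ≤ 233 * (n ^ 2 * d) := by
    have e1 : d ≤ n ^ 2 * d := Nat.le_mul_of_pos_left _ (by positivity)
    have e2 : n ^ 2 ≤ n ^ 2 * d := Nat.le_mul_of_pos_right _ (by positivity)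
    have e3 : n ≤ n ^ 2 := Nat.le_self_pow (by norm_num) n
    nlinarith
  have h3 : (n : ℝ) ^ 2 * (1 / 4) ≤ (n : ℝ) * d * Real.logb (1 + δ) d +
      (n : ℝ) ^ 2 * Real.log (Real.logb (1 + δ) d) := by
    have : 0 ≤ (n : ℝ) * d * Real.logb (1 + δ) d := by positivity
    have := mul_le_mul_of_nonneg_left hlog (sq_nonneg (n : ℝ))
    linarith
  have h4 : 1 / δ ^ 2 ≤ Real.log ((n : ℝ) * d) / δ ^ 2 := by gcongr
  calc ((d * 14 + 100 + n * (n * (d * 34 + 40) + 45) : ℕ) : ℝ) ≤ 233 * (n ^ 2 * d) := by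
        exact_mod_cast h2
    _ ≤ 233 * (n ^ 2 * (1 / δ ^ 2)) := by gcongr
    _ ≤ 1000 * (1 / δ ^ 2 * (n ^ 2 * (1 / 4))) := by
      have : 0 ≤ (n : ℝ) ^ 2 * (1 / δ ^ 2) := by positivity
      linarith
    _ ≤ 1000 * nnTimeBound δ n d := by
      unfold nnTimeBound
      gcongr

theorem sketch_time_le {δ : ℝ} {n d C : ℕ} (hδ : 0 < δ) (hδ2 : δ < 1 / 2) (hn : 2 ≤ n)
    (hd : 2 ≤ d) (hC : 0 < C) (hk : 1 ≤ δ * paramInv δ d) :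
    ((d * 14 + Nat.clog 2 (n * d) * 14 + 100 +
        Nat.clog 2 (16 * d) *
          (sketchLength C δ n d * (d * 22 + n * (d * 28 + 23) + 20) + 20) +
        n * (Nat.clog 2 (Nat.clog 2 (16 * d)) * (n * (sketchLength C δ n d * 34 + 40) + 42) +
          (n * (sketchLength C δ n d * 34 + 40) + 45)) : ℕ) : ℝ) ≤
      41000 * C * nnTimeBound δ n d := by
  obtain ⟨hl, hYd, hY, hlog⟩ := timeBound_facts hδ hδ2 hn hd
  have hn' : (2 : ℝ) ≤ n := by exact_mod_cast hn
  have hd' : (2 : ℝ) ≤ d := by exact_mod_cast hd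
  have hnd : 4 ≤ n * d := by nlinarith
  have hmpos := sketchLength_pos hn hd hC hk
  have hm : (sketchLength C δ n d : ℝ) ≤ 7 * C * (Real.log ((n : ℝ) * d) / δ ^ 2) := by
    have h1 : (Nat.clog 2 (n * d) : ℝ) ≤ 3 * Real.log ((n : ℝ) * d) := by
      have := clog_le_log (N := n * d) (by omega)
      rw [Nat.cast_mul] at this
      linarith
    have h2 := paramInv_le hδ hδ2 d
    rw [mul_div_assoc', le_div_iff₀ (by positivity), sketchLength]
    push_cast
    calc (C : ℝ) * paramInv δ d * paramInv δ d * Nat.clog 2 (n * d) * δ ^ 2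
        = C * ((δ * paramInv δ d) * (δ * paramInv δ d)) * Nat.clog 2 (n * d) := by ring
      _ ≤ C * (3 / 2 * (3 / 2)) * (3 * Real.log ((n : ℝ) * d)) := by gcongr
      _ ≤ 7 * C * Real.log ((n : ℝ) * d) := by
        have : 0 ≤ (C : ℝ) * Real.log ((n : ℝ) * d) := by positivity
        nlinarith
  have hL : (Nat.clog 2 (16 * d) : ℝ) ≤ 5 * Real.logb (1 + δ) d := by
    have h1 := clog_le_log (N := 16 * d) (by omega)
    have h2 : Real.log (16 : ℝ) = 4 * Real.log 2 := by
      rw [show (16 : ℝ) = 2 ^ 4 by norm_num, Real.log_pow]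
      norm_num
    have h3 := Real.log_two_gt_d9
    have h4 : Real.log 2 ≤ Real.log d := Real.log_le_log (by norm_num) hd'
    rw [Nat.cast_mul, Real.log_mul (by norm_num) (by positivity)] at h1
    norm_num at h1
    rw [h2] at h1
    linarith
  have hLpos : 4 ≤ Nat.clog 2 (16 * d) := by
    have : Nat.clog 2 (2 ^ 4) ≤ Nat.clog 2 (16 * d) := Nat.clog_mono_right 2 (by omega)
    rwa [Nat.clog_pow 2 4 (by norm_num)] at this
  -- The additive constants from rounding and from `log 5` are absorbed using `1 / 4 ≤ log log_{1+δ}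
  -- d`.
  have hI : (Nat.clog 2 (Nat.clog 2 (16 * d)) : ℝ) + 1 ≤
      24 * Real.log (Real.logb (1 + δ) d) := by
    have h1 := clog_le_log (N := Nat.clog 2 (16 * d)) (by omega)
    have h2 : Real.log (Nat.clog 2 (16 * d) : ℝ) ≤ Real.log 5 + Real.log (Real.logb (1 + δ) d) := by
      rw [← Real.log_mul (by norm_num) (by positivity)]
      exact Real.log_le_log (by positivity) hL
    have h3 : Real.log (5 : ℝ) ≤ 2.08 := by
      have : Real.log (5 : ℝ) ≤ Real.log (2 ^ 3) := Real.log_le_log (by norm_num) (by norm_num)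
      rw [Real.log_pow] at this
      have := Real.log_two_lt_d9
      norm_num at *
      linarith
    linarith
  obtain ⟨m, hm'⟩ : ∃ m, m = sketchLength C δ n d := ⟨_, rfl⟩
  obtain ⟨L, hL'⟩ : ∃ L, L = Nat.clog 2 (16 * d) := ⟨_, rfl⟩
  obtain ⟨I, hI'⟩ : ∃ I, I = Nat.clog 2 L := ⟨_, rfl⟩
  rw [← hm'] at hmpos hm ⊢
  rw [← hL'] at hLpos hL hI ⊢
  rw [← hI'] at hI ⊢
  have hℓ := clog_le_self (n * d)
  have h1 : L * (m * (d * 22 + n * (d * 28 + 23) + 20) + 20) ≤ 113 * (m * (L * (n * d))) := by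
    have e1 : d * 22 + n * (d * 28 + 23) + 20 ≤ 93 * (n * d) := by nlinarith
    have e2 : 20 ≤ 20 * (m * (n * d)) := by
      have := Nat.mul_pos hmpos (show 0 < n * d by omega)
      omega
    calc L * (m * (d * 22 + n * (d * 28 + 23) + 20) + 20)
        ≤ L * (m * (93 * (n * d)) + 20 * (m * (n * d))) := by gcongr
      _ = 113 * (m * (L * (n * d))) := by ring
  have h2 : n * (I * (n * (m * 34 + 40) + 42) + (n * (m * 34 + 40) + 45)) ≤
      119 * (m * (n ^ 2 * (I + 1))) := by
    have e0 : 1 ≤ n * m := Nat.mul_pos (by omega) hmpos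
    have e1 : n * (m * 34 + 40) + 45 ≤ 119 * (n * m) := by nlinarith
    calc n * (I * (n * (m * 34 + 40) + 42) + (n * (m * 34 + 40) + 45))
        ≤ n * (I * (119 * (n * m)) + 119 * (n * m)) := by
          gcongr
          omega
      _ = 119 * (m * (n ^ 2 * (I + 1))) := by ring
  have h3 : d * 14 + Nat.clog 2 (n * d) * 14 + 100 ≤ 128 * (m * (L * (n * d))) := by
    have e1 : n * d ≤ m * (L * (n * d)) := by
      rw [← mul_assoc]
      exact Nat.le_mul_of_pos_left _ (Nat.mul_pos hmpos (by omega))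
    have e2 : d ≤ n * d := Nat.le_mul_of_pos_left _ (by omega)
    omega
  have h4 := add_le_add (add_le_add h3 h1) h2
  refine (Nat.cast_le (α := ℝ).2 h4).trans ?_
  push_cast
  obtain ⟨Y, hYY⟩ : ∃ Y, Y = Real.logb (1 + δ) d := ⟨_, rfl⟩
  unfold nnTimeBound
  rw [← hYY] at hL hI hY hlog ⊢
  calc (128 : ℝ) * (m * (L * (n * d))) + 113 * (m * (L * (n * d))) +
        119 * (m * (n ^ 2 * (I + 1)))
      ≤ 241 * (m * (L * (n * d) + n ^ 2 * (I + 1))) := by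
        have : 0 ≤ (m : ℝ) * (n ^ 2 * (I + 1)) := by positivity
        linarith
    _ ≤ 241 * (7 * C * (Real.log ((n : ℝ) * d) / δ ^ 2) *
        (5 * Y * (n * d) + n ^ 2 * (24 * Real.log Y))) := by gcongr
    _ ≤ 241 * (7 * C * (Real.log ((n : ℝ) * d) / δ ^ 2) *
        (24 * (n * d * Y + n ^ 2 * Real.log Y))) := by
        gcongr
        have : 0 ≤ (n : ℝ) * d * Y := by positivity
        linarith
    _ = 40488 * (C * (Real.log ((n : ℝ) * d) / δ ^ 2 * (n * d * Y + n ^ 2 * Real.log Y))) := by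
        ring
    _ ≤ 41000 * C * (Real.log ((n : ℝ) * d) / δ ^ 2 * (n * d * Y + n ^ 2 * Real.log Y)) := by
        have : 0 ≤ (C : ℝ) * (Real.log ((n : ℝ) * d) / δ ^ 2 *
          (n * d * Y + n ^ 2 * Real.log Y)) := by positivity
        linarith

theorem diffCount_inputState {n d : ℕ} (y : Fin n → Fin d → Bool) (a b : Fin n) :
    diffCount (fun a j => (inputState y).mem (a * d + j)) d a b = hammingDist (y a) (y b) := by
  rw [diffCount, ← Fin.sum_univ_eq_sum_range (fun j => if (inputState y).mem (a * d + j) =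
    (inputState y).mem (b * d + j) then 0 else 1), hammingDist, Finset.card_filter]
  refine Finset.sum_congr rfl fun j _ => ?_
  rw [inputState_mem, inputState_mem]
  cases y a j <;> cases y b j <;> simp

end WordRAM

/-- For every constant `α ≥ 1` there are a single program of the randomized word RAM and constants
`c`, `K` such that, whenever `δ ∈ (0, 1/2)`, `n, d ≥ 2`, and a word can hold all numbers below
`(n d) ^ c`, the program given `δ` and any enumeration `x` of any set `S` of `n` points of `{0,1}^d`
always halts within `K` times the time bound, and with probability at least `1 - (n d) ^ (-α)` it
has written, for each point of `S` at once, the index of a `δ`-approximate nearest neighbour of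
that point in `S` into the memory cells following the input. -/
theorem mainTheorem9 (α : ℝ) (hα : 1 ≤ α) :
    ∃ (prog : WordRAM.Prog) (c : ℕ) (K : ℝ),
      ∀ (δ : ℝ), 0 < δ → δ < 1 / 2 →
      ∀ (n d : ℕ), 2 ≤ n → 2 ≤ d →
      ∀ (S : Finset (Fin d → Bool)) (x : Fin n ≃ {a : Fin d → Bool // a ∈ S}),
      ∀ (w : ℕ), (n * d) ^ c ≤ 2 ^ w →
        (∀ ω : ℕ → Fin (2 ^ w), ∃ (s : WordRAM.State) (t : ℕ),
          WordRAM.Exec w δ ω prog (WordRAM.inputState fun i => (x i : Fin d → Bool)) s t ∧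
            (t : ℝ) ≤ K * nnTimeBound δ n d) ∧
        ENNReal.ofReal (1 - 1 / ((n : ℝ) * d) ^ α) ≤
          WordRAM.randomWords w
            {ω | ∃ (s : WordRAM.State) (t : ℕ),
              WordRAM.Exec w δ ω prog (WordRAM.inputState fun i => (x i : Fin d → Bool)) s t ∧
                ∀ i : Fin n, ∃ j : Fin n, s.mem (n * d + i) = j ∧
                  IsApproxNearestNeighbor δ S (x i) (x j)} := by
  obtain ⟨C, hC⟩ := exists_nat_ge (5000 * (α + 6))
  have hC0 : 0 < C := by
    rcases Nat.eq_zero_or_pos C with rfl | h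
    · norm_num at hC
      linarith
    · exact h
  refine ⟨WordRAM.nnProg C, C + 9, 41000 * C, fun δ hδ hδ2 n d hn hd S x w hw => ?_⟩
  obtain ⟨y, hy⟩ : ∃ y : Fin n → Fin d → Bool, y = fun i => (x i : Fin d → Bool) := ⟨_, rfl⟩
  rw [← hy]
  have hyx : ∀ i, (x i : Fin d → Bool) = y i := fun i => by rw [hy]
  have happrox : ∀ i j : Fin n, (j : ℕ) ≠ i →
      (∀ k : Fin n, (k : ℕ) ≠ i →
        (hammingDist (y i) (y j) : ℝ) ≤ (1 + δ) * hammingDist (y i) (y k)) →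
      IsApproxNearestNeighbor δ S (x i) (x j) := by
    intro i j hji h
    refine ⟨?_, fun c hc => ?_⟩
    · rw [Finset.mem_sdiff, Finset.mem_singleton, Subtype.coe_inj, x.injective.eq_iff]
      exact ⟨(x j).2, fun h => hji (congrArg _ h)⟩
    · rw [Finset.mem_sdiff, Finset.mem_singleton] at hc
      obtain ⟨k, hk⟩ := x.surjective ⟨c, hc.1⟩
      have hkc : (x k : Fin d → Bool) = c := by rw [hk]
      rw [← hkc, hyx, hyx, hyx]
      refine h k fun hki => hc.2 ?_
      rw [← hkc, Fin.ext hki]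
  obtain ⟨h1, h2, h3, h4, h5⟩ := WordRAM.word_bounds (C := C) (δ := δ) hn hd hw
  have hdn : d ≤ n * d := Nat.le_mul_of_pos_left _ (by omega)
  have hnn : n ≤ n * d := Nat.le_mul_of_pos_right _ (by omega)
  rw [WordRAM.inputState_eq_conf]
  by_cases hk : 1 ≤ δ * WordRAM.paramInv δ d
  · have hrun := fun ω : ℕ → Fin (2 ^ w) =>
      WordRAM.runs_nnProg_sketch (ω := ω) (M := (WordRAM.inputState y).mem) hδ hn
      (by omega : 0 < d) hC0 hk h1 (by omega) h3 h4 h5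
    refine ⟨fun ω => ?_, ?_⟩
    · obtain ⟨s, t, hs, ht, -⟩ := hrun ω
      exact ⟨s, t, hs, (Nat.cast_le.2 ht).trans (WordRAM.sketch_time_le hδ hδ2 hn hd hC0 hk)⟩
    · have hmpos : 0 < WordRAM.sketchLength C δ n d := WordRAM.sketchLength_pos hn hd hC0 hk
      have hpow : 16 * d ≤ 2 ^ Nat.clog 2 (16 * d) := Nat.le_pow_clog (by norm_num) _
      have hL2 : 2 ≤ Nat.clog 2 (16 * d) := by
        by_contra hL
        have : 2 ^ Nat.clog 2 (16 * d) ≤ 2 ^ 1 := Nat.pow_le_pow_right (by norm_num) (by omega)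
        omega
      -- All sampling rates must be realizable by divisibility of a `w`-bit word.
      have hLw : Nat.clog 2 (16 * d) ≤ w :=
        (Nat.clog_le_iff_le_pow (by norm_num)).2 (by omega)
      have hprob := WordRAM.measure_sketch_close y (m := WordRAM.sketchLength C δ n d) hLw hδ.le
      have hfail := WordRAM.failure_le hn hd hC hk
      refine (ENNReal.ofReal_le_ofReal ((sub_le_sub_left hfail 1).trans hprob)).trans ?_
      rw [ofReal_measureReal]
      refine measure_mono fun ω hω => ?_
      obtain ⟨s, t, hs, -, hsel⟩ := hrun ω
      refine ⟨s, t, hs, fun i => ?_⟩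
      have hsel := hsel i i.2
      obtain ⟨b, hb⟩ : ∃ b, b = s.mem (n * d + i) := ⟨_, rfl⟩
      rw [← hb] at hsel ⊢
      obtain ⟨hbn, hbi⟩ : b < n ∧ b ≠ i := by
        obtain ⟨_, -, h, -⟩ := hsel
        exact ⟨h.1, h.2.1⟩
      refine ⟨⟨b, hbn⟩, rfl, happrox i ⟨b, hbn⟩ hbi fun k hki => ?_⟩
      -- The value `0` at indices `b ≥ n` is a dummy: only rows below `n` are compared.
      have key := hsel.le_mul
        (H := fun b => if h : b < n then hammingDist (y i) (y ⟨b, h⟩) else 0) hδ hδ2 hmpos hL2 hpow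
        ?_ ?_ k k.2 hki
      · simpa [hbn] using key
      · intro b hb hbi
        simp only [hb, dif_pos]
        refine ⟨Nat.one_le_iff_ne_zero.2 fun h0 => hbi ?_, ?_⟩
        · rw [hammingDist_eq_zero, ← hyx, ← hyx, Subtype.coe_inj, x.injective.eq_iff] at h0
          rw [h0]
        · exact hammingDist_le_card_fintype.trans (by simp)
      · intro l hl b hb hbi
        simp only [hb, dif_pos]
        exact hω l hl i ⟨b, hb⟩
  · have hrun := fun ω : ℕ → Fin (2 ^ w) =>
      WordRAM.runs_nnProg_exact (ω := ω) (C := C) (M := (WordRAM.inputState y).mem) hδ hn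
      (by omega : 0 < d) hk (by omega) h2
    refine ⟨fun ω => ?_, ?_⟩
    · obtain ⟨s, t, hs, ht, -⟩ := hrun ω
      refine ⟨s, t, hs, ((Nat.cast_le.2 ht).trans (WordRAM.exact_time_le hδ hδ2 hn hd hk)).trans ?_⟩
      refine mul_le_mul_of_nonneg_right ?_ (WordRAM.nnTimeBound_nonneg hδ hδ2 hn hd)
      have : (1 : ℝ) ≤ C := by exact_mod_cast hC0
      linarith
    -- The exact branch succeeds for every choice of the random words, so the event has probability
    -- `1`.
    · refine (ENNReal.ofReal_le_one.2 (sub_le_self _ (by positivity))).trans ?_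
      rw [← measure_univ (μ := WordRAM.randomWords w)]
      refine measure_mono fun ω _ => ?_
      obtain ⟨s, t, hs, -, hsel⟩ := hrun ω
      refine ⟨s, t, hs, fun i => ?_⟩
      obtain ⟨_, -, ⟨hbn, hbi, hmin⟩, -⟩ := hsel i i.2
      refine ⟨⟨_, hbn⟩, rfl, happrox i ⟨_, hbn⟩ hbi fun k hki => ?_⟩
      have hle := hmin k k.2 hki
      rw [WordRAM.diffCount_inputState y i ⟨_, hbn⟩, WordRAM.diffCount_inputState y i k] at hle
      have hle' : (hammingDist (y i) (y ⟨_, hbn⟩) : ℝ) ≤ hammingDist (y i) (y k) := by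
        exact_mod_cast hle
      nlinarith [Nat.cast_nonneg (α := ℝ) (hammingDist (y i) (y k))]
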